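/- Let $d\ge 1$ be an integer, $\alpha\in\mathbb R$, $0\le\sigma\le 1$. Let $\mathcal H_r=\ell^2(\mathbb Z)$ (reservoir) with canonical basis $(\Psi_j)_{j\in\mathbb Z}$ and $\mathcal H_s=\ell^2(\{0,\dots,d-1\})$ (sample) with canonical basis $(e_j)_{0\le j<d}$. Let $\mathcal F_-(\mathcal H_r)$, $\mathcal F_-(\mathcal H_s)$ be the antisymmetric Fock spaces, with fermionic creation and annihilation operators $b^*(\phi),b(\phi)$ and $a^*(\psi),a(\psi)$ respectively, let $b_j^\#=b^\#(\Psi_j)$, $a_j^\#=a^\#(e_j)$, and let $\mathcal B$, $\mathcal A$ be the C*-algebras that they generate. On $\mathcal F_-(\mathcal H_r)\otimes\mathcal F_-(\mathcal H_s)$ consider the one-step unitary $$U=(\Gamma(S)\otimes\Gamma(S_p))\,\exp\!\big[-i\alpha\,(b_0^*\otimes a_0+b_0\otimes a_0^*)\big],$$ where $\Gamma$ denotes second quantization, $S\Psi_j=\Psi_{j-1}$ is the shift, and $S_pe_j=e_{j-1}$ for $1\le j\le d-1$, $S_pe_0=e_{d-1}$ is the periodic shift. For $t\in\mathbb N$ let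 $\tau^t(X)=U^{*t}XU^t$ for $X\in\mathcal B\otimes\mathcal A$. Let $\omega$ be the gauge-invariant quasi-free state on $\mathcal B$ with density $\Sigma=\sigma\mathbb I$, i.e. the state satisfying $$\omega\big(b^*(\phi_m)\cdots b^*(\phi_1)\,b(\psi_1)\cdots b(\psi_n)\big)=\delta_{nm}\det\big(\langle\psi_j|\Sigma\phi_k\rangle\big)_{j,k}$$ for all $m,n\in\mathbb N$ and all $\phi_1,\dots,\phi_m,\psi_1,\dots,\psi_n\in\mathcal H_r$, and let the initial state of the sample be the vacuum, $\rho=|\Omega\rangle\langle\Omega|$. Let $N_s=\sum_{i=0}^{d-1}a_i^*a_i$, let $P_p$ be the orthogonal projection of $\mathcal F_-(\mathcal H_s)$ onto the eigenspace of $N_s$ for the eigenvalue $p$, and for $m\in\mathbb N$ let $$\mathbb P_m(N_s=p)=(\omega\otimes\rho)\big(\tau^{md}(\mathbb I\otimes P_p)\big)$$ be the probability of finding $p$ particles in the sample at time $md$. Then, for all $m,p\in\mathbb N$, $(1-\cos^{2m}\alpha)\sigma\in[0,1]$ and $$\mathbb P_m(N_s=p)=\binom dp\big[(1-\cos^{2m}\alpha)\,\sigma\big]^p\big[1-(1-\cos^{2m}\alpha)\,\sigma\big]^{d-p}$$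 (with value $0$ for $p>d$), i.e. the number of particles in the sample at time $md$ has the binomial distribution $B\big(d,(1-\cos^{2m}\alpha)\sigma\big)$. -/

import Mathlib

namespace QuantumWalk

open scoped lp TensorProduct InnerProductSpace ComplexOrder

noncomputable section

/-- The one-particle Hilbert space `ℓ²(ι)`. -/
abbrev OneParticle (ι : Type) := ℓ²(ι, ℂ)

/-- The antisymmetric Fock space over `ℓ²(ι)`, in its occupation number representation: the
coordinate of a vector at the finite set `S = {j₁ < ⋯ < j_p}` is its coefficient along the unit
vector `e_{j₁} ∧ ⋯ ∧ e_{j_p}`, and these vectors form an orthonormal basis. The `p`-particle sector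
corresponds to the sets `S` with `p` elements. -/
abbrev Fock (ι : Type) := ℓ²(Finset ι, ℂ)

section FockSpace

variable {ι : Type} [LinearOrder ι]

/-- The canonical basis vector of `ℓ²(ι)` at the site `i`. -/
def site (i : ι) : OneParticle ι := lp.single 2 i 1

/-- The basis vector `e_{j₁} ∧ ⋯ ∧ e_{j_p}` for `S = {j₁ < ⋯ < j_p}` (see `elementary_site`). -/
def occ (S : Finset ι) : Fock ι := lp.single 2 S 1

/-- The vacuum vector. -/
def vacuum : Fock ι := occ ∅

/-- The sign `(-1)^#{j ∈ S | j < i}` relating `e_i ∧ e_{j₁} ∧ ⋯ ∧ e_{j_p}` to the basis vector of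
`S ∪ {i}`, for `S = {j₁ < ⋯ < j_p}` not containing `i`. -/
def wedgeSign (i : ι) (S : Finset ι) : ℂ := (-1) ^ (S.filter (· < i)).card

lemma norm_wedgeSign (i : ι) (S : Finset ι) : ‖wedgeSign i S‖ = 1 := by
  simp [wedgeSign]

lemma wedgeSign_mul_self (i : ι) (S : Finset ι) : wedgeSign i S * wedgeSign i S = 1 := by
  simp [wedgeSign, ← mul_pow]

lemma star_wedgeSign (i : ι) (S : Finset ι) :
    (starRingEnd ℂ) (wedgeSign i S) = wedgeSign i S := by
  simp [wedgeSign]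

lemma wedgeSign_insert {i j : ι} {S : Finset ι} (hj : j ∉ S) :
    wedgeSign i (insert j S) = (if j < i then -1 else 1) * wedgeSign i S := by
  unfold wedgeSign
  rw [Finset.filter_insert]
  split_ifs with h
  · rw [Finset.card_insert_of_notMem (by simp [hj]), pow_succ]; ring
  · simp

lemma wedgeSign_erase {i j : ι} {S : Finset ι} (hj : j ∈ S) :
    wedgeSign i (S.erase j) = (if j < i then -1 else 1) * wedgeSign i S := by
  conv_rhs => rw [← Finset.insert_erase hj]
  rw [wedgeSign_insert (by simp)]
  split_ifs <;> simp

lemma wedge_summable (i : ι) (f : Fock ι) :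
    Summable (fun S : Finset ι ↦
      ‖(if i ∈ S then wedgeSign i S * f (S.erase i) else 0)‖ ^ 2) ∧
    ∑' S : Finset ι, ‖(if i ∈ S then wedgeSign i S * f (S.erase i) else 0)‖ ^ 2 ≤ ‖f‖ ^ 2 := by
  have hf : HasSum (fun S ↦ ‖f S‖ ^ 2) (‖f‖ ^ 2) := by
    have := lp.hasSum_norm (p := 2) (by simp) f
    simpa using this
  have heq : (fun S : Finset ι ↦ ‖(if i ∈ S then wedgeSign i S * f (S.erase i) else 0)‖ ^ 2)
      = Set.indicator {S : Finset ι | i ∈ S} (fun S ↦ ‖f (S.erase i)‖ ^ 2) := by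
    ext S
    by_cases h : i ∈ S <;> simp [h, norm_wedgeSign]
  have hinj : Function.Injective
      (fun S : {S : Finset ι | i ∈ S} ↦ (S : Finset ι).erase i) := by
    rintro ⟨S, hS⟩ ⟨T, hT⟩ h
    simp only at h
    have h2 := congrArg (insert i) h
    rw [Finset.insert_erase hS, Finset.insert_erase hT] at h2
    exact Subtype.ext h2
  rw [heq]
  have hs : Summable (fun S : {S : Finset ι | i ∈ S} ↦ ‖f ((S : Finset ι).erase i)‖ ^ 2) :=
    hf.summable.comp_injective hinj
  refine ⟨summable_subtype_iff_indicator.mp hs, ?_⟩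
  rw [← tsum_subtype, ← hf.tsum_eq]
  exact hs.tsum_le_tsum_of_inj _ hinj (fun _ _ ↦ by positivity) (fun _ ↦ le_rfl) hf.summable

/-- The creation operator `ψ ↦ e_i ∧ ψ` at the site `i` (see `createSite_occ`). -/
def createSite (i : ι) : Fock ι →L[ℂ] Fock ι :=
  LinearMap.mkContinuous
    { toFun := fun f ↦ ⟨fun S ↦ if i ∈ S then wedgeSign i S * f (S.erase i) else 0,
        (memℓp_gen_iff (by simp)).mpr (by simpa using (wedge_summable i f).1)⟩
      map_add' := fun f g ↦ by
        ext S
        change (if i ∈ S then wedgeSign i S * (f (S.erase i) + g (S.erase i)) else 0) =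
          (if i ∈ S then wedgeSign i S * f (S.erase i) else 0) +
          (if i ∈ S then wedgeSign i S * g (S.erase i) else 0)
        split_ifs <;> ring
      map_smul' := fun c f ↦ by
        ext S
        change (if i ∈ S then wedgeSign i S * (c * f (S.erase i)) else 0) =
          c * (if i ∈ S then wedgeSign i S * f (S.erase i) else 0)
        split_ifs <;> ring } 1 (fun f ↦ by
        rw [one_mul]
        refine lp.norm_le_of_tsum_le (by simp) (norm_nonneg _) ?_
        simpa using (wedge_summable i f).2)

lemma createSite_apply (i : ι) (f : Fock ι) (S : Finset ι) :
    createSite i f S = if i ∈ S then wedgeSign i S * f (S.erase i) else 0 := rfl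

lemma occ_apply (S T : Finset ι) : occ S T = if T = S then 1 else 0 := by
  simp [occ, lp.single_apply, Pi.single_apply]

lemma inner_occ (S : Finset ι) (f : Fock ι) : ⟪occ S, f⟫_ℂ = f S := by
  simp [occ, lp.inner_single_left]

lemma createSite_occ (i : ι) (S : Finset ι) :
    createSite i (occ S) = if i ∈ S then 0 else wedgeSign i S • occ (insert i S) := by
  ext T
  rw [createSite_apply, occ_apply]
  by_cases hS : i ∈ S
  · have : T.erase i ≠ S := by rintro rfl; simp at hS
    simp [hS, this]
  · by_cases hT : i ∈ T
    · by_cases h : T = insert i S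
      · subst h
        simp [hS, occ_apply, wedgeSign_insert]
      · have : T.erase i ≠ S := by rintro rfl; exact h (by simp [hT])
        simp [hS, hT, this, occ_apply, h]
    · have : T ≠ insert i S := by rintro rfl; simp at hT
      simp [hS, hT, occ_apply, this]

lemma annihSite_apply (i : ι) (f : Fock ι) (S : Finset ι) :
    star (createSite i) f S = if i ∈ S then 0 else wedgeSign i S * f (insert i S) := by
  rw [← inner_occ, ContinuousLinearMap.star_eq_adjoint, ContinuousLinearMap.adjoint_inner_right,
    createSite_occ]
  split_ifs
  · simp
  · rw [inner_smul_left, inner_occ, star_wedgeSign]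

lemma op_mul_apply {E : Type} [NormedAddCommGroup E] [NormedSpace ℂ E] (A B : E →L[ℂ] E) (x : E) :
    (A * B) x = A (B x) := rfl

lemma createSite_anticomm (i j : ι) :
    createSite i * createSite j + createSite j * createSite i = 0 := by
  ext f S
  simp only [add_apply, op_mul_apply, lp.coeFn_add,
    Pi.add_apply, createSite_apply, zero_apply, lp.coeFn_zero, Pi.zero_apply]
  rcases eq_or_ne i j with rfl | hij
  · simp
  · by_cases hi : i ∈ S <;> by_cases hj : j ∈ S <;>
      simp [hi, hj, hij, hij.symm, wedgeSign_erase, Finset.erase_right_comm (a := i) (b := j)]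
    rcases lt_or_gt_of_ne hij with h | h <;> simp [h, h.not_gt] <;> ring

lemma annihSite_createSite (i j : ι) :
    star (createSite i) * createSite j + createSite j * star (createSite i) =
      (if i = j then (1 : ℂ) else 0) • (1 : Fock ι →L[ℂ] Fock ι) := by
  ext f S
  simp only [add_apply, op_mul_apply, lp.coeFn_add,
    Pi.add_apply, createSite_apply, annihSite_apply, smul_apply,
    one_apply_eq_self, lp.coeFn_smul, Pi.smul_apply]
  rcases eq_or_ne i j with rfl | hij
  · by_cases hi : i ∈ S
    · simp [hi, wedgeSign_erase, ← mul_assoc, wedgeSign_mul_self]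
    · simp [hi, wedgeSign_insert, ← mul_assoc, wedgeSign_mul_self]
  · by_cases hi : i ∈ S <;> by_cases hj : j ∈ S <;>
      simp [hi, hj, hij, hij.symm, wedgeSign_erase, wedgeSign_insert]
    rw [Finset.erase_insert_of_ne hij]
    rcases lt_or_gt_of_ne hij with h | h <;> simp [h, h.not_gt] <;> ring

lemma norm_sum_createSite_le (s : Finset ι) (c : ι → ℂ) :
    ‖∑ i ∈ s, c i • createSite i‖ ≤ Real.sqrt (∑ i ∈ s, ‖c i‖ ^ 2) := by
  set X := ∑ i ∈ s, c i • createSite i with hX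
  have hCAR : star X * X + X * star X =
      ((∑ i ∈ s, ‖c i‖ ^ 2 : ℝ) : ℂ) • (1 : Fock ι →L[ℂ] Fock ι) := by
    simp only [hX, star_sum, star_smul, Finset.sum_mul_sum]
    rw [Finset.sum_comm (f := fun i j ↦ c i • createSite i * star (c j) • star (createSite j)),
      ← Finset.sum_add_distrib]
    simp only [← Finset.sum_add_distrib]
    have : ∀ i ∈ s, ∀ j ∈ s, star (c i) • star (createSite i) * c j • createSite j +
        c j • createSite j * star (c i) • star (createSite i) =
        (if i = j then (star (c i) * c j) else 0) • (1 : Fock ι →L[ℂ] Fock ι) := by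
      intro i _ j _
      have h := annihSite_createSite i j
      simp only [smul_mul_smul_comm]
      rw [mul_comm (c j), ← smul_add, h, smul_smul]
      split_ifs <;> simp
    rw [Finset.sum_congr rfl (fun i hi ↦ Finset.sum_congr rfl (this i hi))]
    simp only [← Finset.sum_smul]
    congr 1
    simp only [Finset.sum_ite_eq, Complex.ofReal_sum]
    refine Finset.sum_congr rfl fun i hi ↦ ?_
    rw [if_pos hi]
    simp [Complex.conj_mul']
  refine ContinuousLinearMap.opNorm_le_bound _ (Real.sqrt_nonneg _) fun f ↦ ?_
  have h1 : ‖X f‖ ^ 2 + ‖star X f‖ ^ 2 = (∑ i ∈ s, ‖c i‖ ^ 2) * ‖f‖ ^ 2 := by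
    have h2 := congrArg (fun T : Fock ι →L[ℂ] Fock ι ↦ ⟪f, T f⟫_ℂ) hCAR
    simp only [add_apply, op_mul_apply, inner_add_right,
      smul_apply, one_apply_eq_self, inner_smul_right,
      inner_self_eq_norm_sq_to_K] at h2
    rw [ContinuousLinearMap.star_eq_adjoint, ContinuousLinearMap.adjoint_inner_right X f (X f),
      ← ContinuousLinearMap.adjoint_inner_left X (ContinuousLinearMap.adjoint X f) f, inner_self_eq_norm_sq_to_K,
      inner_self_eq_norm_sq_to_K] at h2
    rw [ContinuousLinearMap.star_eq_adjoint]
    refine Complex.ofReal_injective ?_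
    rw [Complex.ofReal_mul, Complex.ofReal_add, Complex.ofReal_pow, Complex.ofReal_pow,
      Complex.ofReal_pow]
    exact h2
  have h3 : ‖X f‖ ^ 2 ≤ (Real.sqrt (∑ i ∈ s, ‖c i‖ ^ 2) * ‖f‖) ^ 2 := by
    rw [mul_pow, Real.sq_sqrt (by positivity)]
    nlinarith [sq_nonneg ‖star X f‖]
  exact abs_le_of_sq_le_sq' h3 (by positivity) |>.2

lemma hasSum_norm_sq (φ : OneParticle ι) : HasSum (fun i ↦ ‖φ i‖ ^ 2) (‖φ‖ ^ 2) := by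
  have := lp.hasSum_norm (p := 2) (by simp) φ
  simpa using this

lemma summable_create (φ : OneParticle ι) : Summable fun i ↦ φ i • createSite i := by
  rw [summable_iff_vanishing_norm]
  intro ε hε
  obtain ⟨s, hs⟩ := summable_iff_vanishing_norm.mp (hasSum_norm_sq φ).summable (ε ^ 2)
    (by positivity)
  refine ⟨s, fun t ht ↦ (norm_sum_createSite_le t _).trans_lt ?_⟩
  rw [Real.sqrt_lt' hε]
  exact (le_abs_self _).trans_lt (hs t ht)

/-- The creation operator `c^*(φ)`, `ψ ↦ φ ∧ ψ`; it is linear in `φ = ∑ φ_i e_i`, and the series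
converges in operator norm (see `summable_create`). -/
def create (φ : OneParticle ι) : Fock ι →L[ℂ] Fock ι := ∑' i, φ i • createSite i

lemma norm_create_le (φ : OneParticle ι) : ‖create φ‖ ≤ ‖φ‖ := by
  refine le_of_tendsto (summable_create φ).hasSum.norm (Filter.Eventually.of_forall fun s ↦ ?_)
  refine (norm_sum_createSite_le s _).trans ?_
  rw [Real.sqrt_le_left (norm_nonneg _), ← (hasSum_norm_sq φ).tsum_eq]
  exact (hasSum_norm_sq φ).summable.sum_le_tsum s (fun _ _ ↦ by positivity)

/-- The annihilation operator `c(φ)`, the adjoint of `c^*(φ)`. -/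
def annih (φ : OneParticle ι) : Fock ι →L[ℂ] Fock ι := ContinuousLinearMap.adjoint (create φ)

/-- The map `φ ↦ c^*(φ)` as a continuous linear map. -/
def createL : OneParticle ι →L[ℂ] (Fock ι →L[ℂ] Fock ι) :=
  LinearMap.mkContinuous
    { toFun := create
      map_add' := fun φ χ ↦ by
        simp only [create, lp.coeFn_add, Pi.add_apply, add_smul]
        exact (summable_create φ).tsum_add (summable_create χ)
      map_smul' := fun c φ ↦ by
        simp only [create, lp.coeFn_smul, Pi.smul_apply, smul_assoc, RingHom.id_apply]
        exact (summable_create φ).tsum_const_smul c } 1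
    (fun φ ↦ by simpa using norm_create_le φ)

lemma createL_apply (φ : OneParticle ι) : createL φ = create φ := rfl

lemma create_site (i : ι) : create (site i) = createSite i := by
  rw [create, tsum_eq_single i]
  · simp [site]
  · intro j hj
    simp [site, lp.single_apply, hj]

lemma clm_ext_site {E : Type} [NormedAddCommGroup E] [NormedSpace ℂ E]
    {f g : OneParticle ι →L[ℂ] E} (h : ∀ i, f (site i) = g (site i)) : f = g := by
  ext φ
  have hs := lp.hasSum_single (p := 2) (by simp) φ
  refine (hs.mapL f).unique ?_
  convert hs.mapL g using 2 with i
  have : lp.single 2 i (φ i) = φ i • site i := by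
    rw [site, ← lp.single_smul]; simp
  rw [this, map_smul, map_smul, h]

lemma clm_ext_occ {E : Type} [NormedAddCommGroup E] [NormedSpace ℂ E]
    {f g : Fock ι →L[ℂ] E} (h : ∀ S, f (occ S) = g (occ S)) : f = g :=
  by
  ext φ
  have hs := lp.hasSum_single (p := 2) (by simp) φ
  refine (hs.mapL f).unique ?_
  convert hs.mapL g using 2 with i
  have : lp.single 2 i (φ i) = φ i • occ i := by
    rw [occ, ← lp.single_smul]; simp
  rw [this, map_smul, map_smul, h]

lemma create_anticomm (φ χ : OneParticle ι) :
    create φ * create χ + create χ * create φ = 0 := by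
  have key : ∀ i, ∀ χ : OneParticle ι, createSite i * create χ + create χ * createSite i = 0 := by
    intro i χ
    have : (ContinuousLinearMap.mul ℂ _ (createSite i) + 
        (ContinuousLinearMap.mul ℂ _).flip (createSite i)) ∘L createL = 0 := by
      refine clm_ext_site fun j ↦ ?_
      simp [createL_apply, create_site, createSite_anticomm]
    simpa [createL_apply] using congrArg (fun T ↦ T χ) this
  have : (ContinuousLinearMap.mul ℂ _ (create χ) + 
        (ContinuousLinearMap.mul ℂ _).flip (create χ)) ∘L createL = 0 := by
    refine clm_ext_site fun j ↦ ?_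
    have := key j χ
    simp [createL_apply, create_site]
    rw [add_comm]; exact this
  have := congrArg (fun T ↦ T φ) this
  simp [createL_apply] at this
  rw [add_comm]; exact this

lemma inner_site (i : ι) (φ : OneParticle ι) : ⟪site i, φ⟫_ℂ = φ i := by
  simp [site, lp.inner_single_left]

lemma annih_create (φ χ : OneParticle ι) :
    annih φ * create χ + create χ * annih φ = ⟪φ, χ⟫_ℂ • (1 : Fock ι →L[ℂ] Fock ι) := by
  have key : ∀ i, ∀ χ : OneParticle ι,
      star (createSite i) * create χ + create χ * star (createSite i) = χ i • 1 := by
    intro i χ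
    have : (ContinuousLinearMap.mul ℂ _ (star (createSite i)) + 
        (ContinuousLinearMap.mul ℂ _).flip (star (createSite i))) ∘L createL =
        (innerSL ℂ (site i)).smulRight (1 : Fock ι →L[ℂ] Fock ι) := by
      refine clm_ext_site fun j ↦ ?_
      simp [createL_apply, create_site, annihSite_createSite, inner_site]
      simp [site, lp.single_apply, Pi.single_apply]
    simpa [createL_apply, inner_site] using congrArg (fun T ↦ T χ) this
  have : (ContinuousLinearMap.mul ℂ _ (star (create χ)) + 
        (ContinuousLinearMap.mul ℂ _).flip (star (create χ))) ∘L createL =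
        (innerSL ℂ χ).smulRight (1 : Fock ι →L[ℂ] Fock ι) := by
    refine clm_ext_site fun j ↦ ?_
    have := congrArg star (key j χ)
    simp only [star_add, star_mul, star_star, star_smul, star_one] at this
    simp [createL_apply, create_site, this]
    rw [← inner_conj_symm, inner_site]
  have := congrArg (fun T ↦ star (T φ)) this
  simp only [ContinuousLinearMap.comp_apply, createL_apply, add_apply,
    ContinuousLinearMap.mul_apply', ContinuousLinearMap.flip_apply, star_add, star_mul, star_star,
    ContinuousLinearMap.smulRight_apply, star_smul, star_one, innerSL_apply_apply] at this
  rw [annih, ← ContinuousLinearMap.star_eq_adjoint, this]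
  congr 1
  exact inner_conj_symm φ χ

lemma annih_vacuum (φ : OneParticle ι) : annih φ vacuum = 0 := by
  ext S
  rw [← inner_occ, annih, ContinuousLinearMap.adjoint_inner_right]
  have : ∀ f : Fock ι, ⟪create φ f, (vacuum : Fock ι)⟫_ℂ = 0 := by
    intro f
    rw [← inner_conj_symm, vacuum, inner_occ]
    have h := ((summable_create φ).hasSum.mapL
      (ContinuousLinearMap.apply ℂ (Fock ι) f)).mapL (innerSL ℂ (occ ∅))
    have h0 : create φ f ∅ = 0 := by
      rw [← inner_occ]
      refine h.unique ?_
      convert hasSum_zero using 2 with i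
      simp [inner_occ, createSite_apply]
    simp [h0]
  simpa using this _

end FockSpace

section SecondQuantization

variable {ι : Type} [LinearOrder ι]

/-- The elementary vector `u₁ ∧ ⋯ ∧ u_q = c^*(u₁) ⋯ c^*(u_q) Ω`. -/
def elementary (l : List (OneParticle ι)) : Fock ι := (l.map create).prod vacuum

lemma elementary_nil : elementary ([] : List (OneParticle ι)) = vacuum := rfl

lemma elementary_cons (u : OneParticle ι) (l : List (OneParticle ι)) :
    elementary (u :: l) = create u (elementary l) := by
  simp [elementary]

lemma create_create_apply (φ χ : OneParticle ι) (f : Fock ι) :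
    create φ (create χ f) = - create χ (create φ f) := by
  have := congrArg (fun T ↦ T f) (create_anticomm φ χ)
  simp only [add_apply, op_mul_apply, zero_apply] at this
  exact eq_neg_of_add_eq_zero_left this

lemma create_create_self (φ : OneParticle ι) (f : Fock ι) : create φ (create φ f) = 0 := by
  have := create_create_apply φ φ f
  have h2 : (2 : ℂ) • create φ (create φ f) = 0 := by
    rw [two_smul]; nth_rewrite 1 [this]; simp
  simpa using h2

lemma annih_create_apply (φ χ : OneParticle ι) (f : Fock ι) :
    annih φ (create χ f) = ⟪φ, χ⟫_ℂ • f - create χ (annih φ f) := by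
  have := congrArg (fun T ↦ T f) (annih_create φ χ)
  simp only [add_apply, op_mul_apply, smul_apply, one_apply_eq_self] at this
  exact eq_sub_of_add_eq this

section

variable {v : ι → OneParticle ι}

lemma annih_elementary_of_notMem (hv : Orthonormal ℂ v) {i : ι} {l : List ι} (h : i ∉ l) :
    annih (v i) (elementary (l.map v)) = 0 := by
  induction l with
  | nil => simp [elementary_nil, annih_vacuum]
  | cons a l ih =>
    simp only [List.mem_cons, not_or] at h
    rw [List.map_cons, elementary_cons, annih_create_apply, ih h.2, hv.2 h.1]
    simp

lemma create_elementary_of_mem {i : ι} {l : List ι} (h : i ∈ l) :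
    create (v i) (elementary (l.map v)) = 0 := by
  induction l with
  | nil => simp at h
  | cons a l ih =>
    rw [List.map_cons, elementary_cons]
    rcases List.mem_cons.mp h with rfl | h
    · exact create_create_self _ _
    · rw [create_create_apply, ih h]; simp

lemma norm_elementary (hv : Orthonormal ℂ v) {l : List ι} (h : l.Nodup) : ‖elementary (l.map v)‖ = 1 := by
  induction l with
  | nil => simp [elementary_nil, vacuum, occ, lp.norm_single]
  | cons a l ih =>
    rw [List.nodup_cons] at h
    have h1 := ih h.2
    rw [List.map_cons, elementary_cons]
    have h2 : ⟪create (v a) (elementary (l.map v)), create (v a) (elementary (l.map v))⟫_ℂ = 1 := by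
      rw [← ContinuousLinearMap.adjoint_inner_right, ← annih, annih_create_apply,
        annih_elementary_of_notMem hv h.1, inner_self_eq_norm_sq_to_K, hv.1]
      simp [inner_self_eq_norm_sq_to_K, h1]
    rw [inner_self_eq_norm_sq_to_K] at h2
    have h3 : ‖create (v a) (elementary (l.map v))‖ ^ 2 = 1 :=
      Complex.ofReal_injective (by rw [Complex.ofReal_pow, Complex.ofReal_one]; exact h2)
    exact (pow_eq_one_iff_of_nonneg (norm_nonneg _) two_ne_zero).mp h3

lemma inner_elementary (hv : Orthonormal ℂ v) {i : ι} {l l' : List ι} (h : i ∈ l) (h' : i ∉ l') :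
    ⟪elementary (l.map v), elementary (l'.map v)⟫_ℂ = 0 := by
  have h1 : create (v i) (annih (v i) (elementary (l.map v))) = elementary (l.map v) := by
    have := annih_create_apply (v i) (v i) (elementary (l.map v))
    rw [create_elementary_of_mem h, inner_self_eq_norm_sq_to_K, hv.1] at this
    simp only [map_zero, RCLike.ofReal_one, one_pow, one_smul] at this
    exact (sub_eq_zero.mp this.symm).symm
  rw [← h1, ← ContinuousLinearMap.adjoint_inner_right, ← annih,
    annih_elementary_of_notMem hv h', inner_zero_right]

lemma orthonormal_elementary (hv : Orthonormal ℂ v) :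
    Orthonormal ℂ fun S : Finset ι ↦ elementary ((S.sort (· ≤ ·)).map v) := by
  refine ⟨fun S ↦ norm_elementary hv (Finset.sort_nodup S _), fun S T hST ↦ ?_⟩
  have : ∃ i, (i ∈ S ∧ i ∉ T) ∨ (i ∈ T ∧ i ∉ S) := by
    by_contra! h
    exact hST (Finset.ext fun i ↦ ⟨fun hi ↦ (h i).1 hi, fun hi ↦ (h i).2 hi⟩)
  obtain ⟨i, ⟨h1, h2⟩ | ⟨h1, h2⟩⟩ := this
  · exact inner_elementary hv (i := i) (by simpa using h1) (by simpa using h2)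
  · exact inner_eq_zero_symm.mp
      (inner_elementary hv (i := i) (by simpa using h1) (by simpa using h2))

lemma create_elementary_sorted {i : ι} {l : List ι} (hl : l.Pairwise (· ≤ ·)) (hi : i ∉ l) :
    create (v i) (elementary (l.map v)) =
      ((-1 : ℂ) ^ l.countP (· < i)) • elementary ((l.orderedInsert (· ≤ ·) i).map v) := by
  induction l with
  | nil => simp [elementary_cons]
  | cons a l ih =>
    simp only [List.mem_cons, not_or] at hi
    rw [List.pairwise_cons] at hl
    by_cases h : i ≤ a
    · rw [List.orderedInsert_cons_of_le _ _ h, List.countP_eq_zero.mpr]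
      · simp [elementary_cons]
      · intro b hb
        rcases List.mem_cons.mp hb with rfl | hb
        · simpa using h
        · simpa using h.trans (hl.1 b hb)
    · rw [List.orderedInsert_of_not_le _ _ h, List.map_cons, elementary_cons, create_create_apply,
        ih hl.2 hi.2, List.map_cons, elementary_cons, List.countP_cons_of_pos (by simpa using h)]
      simp [pow_succ]

lemma create_elementary_sort {i : ι} {S : Finset ι} (hi : i ∉ S) :
    create (v i) (elementary ((S.sort (· ≤ ·)).map v)) =
      wedgeSign i S • elementary (((insert i S).sort (· ≤ ·)).map v) := by
  rw [create_elementary_sorted (Finset.pairwise_sort S _) (by simpa using hi)]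
  congr 1
  · rw [wedgeSign]
    congr 1
    rw [Finset.card_filter, List.countP_eq_length_filter]
    rw [← Finset.card_filter, ← List.toFinset_card_of_nodup ((Finset.sort_nodup S _).filter _)]
    congr 1
    ext j
    simp
  · congr 2
    refine List.Perm.eq_of_pairwise' (r := (· ≤ ·)) ?_ (Finset.pairwise_sort _ _) ?_
    · exact (Finset.pairwise_sort S _).orderedInsert i _
    · refine (List.perm_orderedInsert _ _ _).trans ?_
      refine (List.perm_ext_iff_of_nodup ?_ (Finset.sort_nodup _ _)).mpr ?_
      · rw [List.nodup_cons]; exact ⟨by simpa using hi, Finset.sort_nodup _ _⟩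
      · simp

end

lemma elementary_site (S : Finset ι) : elementary ((S.sort (· ≤ ·)).map site) = occ S := by
  induction S using Finset.induction_on with
  | empty => simp [elementary_nil, vacuum]
  | insert i S hi ih =>
    have h := create_elementary_sort (v := site) hi
    rw [ih, create_site, createSite_occ, if_neg hi] at h
    have h2 := congrArg (fun x ↦ wedgeSign i S • x) h
    simpa [smul_smul, wedgeSign_mul_self] using h2.symm

lemma orthonormal_site : Orthonormal ℂ (site : ι → OneParticle ι) := by
  rw [orthonormal_iff_ite]
  intro i j
  rw [inner_site]
  simp [site, lp.single_apply, Pi.single_apply]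

/-- The second quantization `Γ(W)` of a unitary `W`, which sends `e_{j₁} ∧ ⋯ ∧ e_{j_p}` to
`W e_{j₁} ∧ ⋯ ∧ W e_{j_p}` (see `secondQuant_occ` and `secondQuant_elementary`). -/
def secondQuant (W : OneParticle ι ≃ₗᵢ[ℂ] OneParticle ι) : Fock ι →L[ℂ] Fock ι :=
  (orthonormal_elementary (orthonormal_site.comp_linearIsometry W.toLinearIsometry)
    ).orthogonalFamily.linearIsometry.toContinuousLinearMap

variable (W : OneParticle ι ≃ₗᵢ[ℂ] OneParticle ι)

lemma secondQuant_occ (S : Finset ι) :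
    secondQuant W (occ S) = elementary ((S.sort (· ≤ ·)).map fun i ↦ W (site i)) := by
  simp only [secondQuant, LinearIsometry.coe_toContinuousLinearMap, occ]
  rw [OrthogonalFamily.linearIsometry_apply_single]
  simp [LinearIsometry.toSpanSingleton_apply, Function.comp_def]

lemma star_secondQuant_mul : star (secondQuant W) * secondQuant W = 1 := by
  rw [ContinuousLinearMap.star_eq_adjoint]
  exact (ContinuousLinearMap.norm_map_iff_adjoint_comp_self _).mp fun x ↦
    LinearIsometry.norm_map _ x

lemma secondQuant_mul_create (φ : OneParticle ι) :
    secondQuant W * create φ = create (W φ) * secondQuant W := by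
  have : (ContinuousLinearMap.mul ℂ _ (secondQuant W)) ∘L createL =
      (ContinuousLinearMap.mul ℂ _).flip (secondQuant W) ∘L createL ∘L
        (W.toContinuousLinearEquiv : OneParticle ι →L[ℂ] OneParticle ι) := by
    refine clm_ext_site fun i ↦ ?_
    change secondQuant W * create (site i) = create (W (site i)) * secondQuant W
    refine clm_ext_occ fun S ↦ ?_
    rw [op_mul_apply, op_mul_apply, create_site, createSite_occ, secondQuant_occ]
    split_ifs with h
    · rw [map_zero]
      exact (create_elementary_of_mem (v := fun i ↦ W (site i)) (by simpa using h)).symm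
    · rw [map_smul, secondQuant_occ]
      exact (create_elementary_sort (v := fun i ↦ W (site i)) h).symm
  exact congrArg (fun T ↦ T φ) this

lemma secondQuant_elementary (l : List (OneParticle ι)) :
    secondQuant W (elementary l) = elementary (l.map W) := by
  induction l with
  | nil => 
    have := secondQuant_occ W ∅
    rw [Finset.sort_empty] at this
    exact this
  | cons u l ih =>
    rw [elementary_cons, List.map_cons, elementary_cons, ← ih, ← op_mul_apply, 
      secondQuant_mul_create, op_mul_apply]

lemma secondQuant_mul_symm : secondQuant W * secondQuant W.symm = 1 := by
  refine clm_ext_occ fun S ↦ ?_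
  rw [op_mul_apply, secondQuant_occ, secondQuant_elementary, one_apply_eq_self,
    ← elementary_site S, List.map_map]
  congr 2
  ext1 i
  simp

lemma star_secondQuant : star (secondQuant W) = secondQuant W.symm := by
  calc star (secondQuant W) = star (secondQuant W) * (secondQuant W * secondQuant W.symm) := by
        rw [secondQuant_mul_symm, mul_one]
    _ = _ := by rw [← mul_assoc, star_secondQuant_mul, one_mul]

lemma secondQuant_mul_star : secondQuant W * star (secondQuant W) = 1 := by
  rw [star_secondQuant, secondQuant_mul_symm]

lemma star_secondQuant_mul_create_mul (φ : OneParticle ι) :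
    star (secondQuant W) * create φ * secondQuant W = create (W.symm φ) := by
  have h := secondQuant_mul_create W (W.symm φ)
  rw [W.apply_symm_apply] at h
  rw [mul_assoc, ← h, ← mul_assoc, star_secondQuant_mul, one_mul]

end SecondQuantization

section Algebras

/-- The C*-algebra generated by the creation and annihilation operators. -/
def carAlgebra (ι : Type) [LinearOrder ι] : StarSubalgebra ℂ (Fock ι →L[ℂ] Fock ι) :=
  (StarAlgebra.adjoin ℂ (Set.range create ∪ Set.range annih)).topologicalClosure

variable {ι : Type} [LinearOrder ι]

lemma create_mem (φ : OneParticle ι) : create φ ∈ carAlgebra ι :=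
  StarSubalgebra.le_topologicalClosure _ (StarAlgebra.subset_adjoin ℂ _ (Or.inl ⟨φ, rfl⟩))

lemma annih_mem (φ : OneParticle ι) : annih φ ∈ carAlgebra ι :=
  StarSubalgebra.le_topologicalClosure _ (StarAlgebra.subset_adjoin ℂ _ (Or.inr ⟨φ, rfl⟩))

lemma conj_mem_closure {A : Type} [CStarAlgebra A] {V : A} (hV : V * star V = 1)
    (hV' : star V * V = 1) {s : Set A}
    {B : StarSubalgebra ℂ A} (hB : IsClosed (B : Set A)) (h : ∀ x ∈ s, star V * x * V ∈ B) {x : A}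
    (hx : x ∈ (StarAlgebra.adjoin ℂ s).topologicalClosure) : star V * x * V ∈ B := by
  have hc : Continuous fun x ↦ star V * x * V := by fun_prop
  have h1 : (StarAlgebra.adjoin ℂ s : Set A) ⊆ {x | star V * x * V ∈ B} := by
    intro y hy
    refine StarAlgebra.adjoin_induction (p := fun x _ ↦ star V * x * V ∈ B) h ?_ ?_ ?_ ?_ hy
    · intro r
      rw [Algebra.algebraMap_eq_smul_one, mul_smul_comm, smul_mul_assoc, mul_one, hV']
      exact B.smul_mem (one_mem B) r
    · intro x y _ _ hx hy
      rw [mul_add, add_mul]; exact add_mem hx hy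
    · intro x y _ _ hx hy
      have : star V * (x * y) * V = (star V * x * V) * (star V * y * V) := by
        calc star V * (x * y) * V = star V * x * 1 * y * V := by simp [mul_assoc]
          _ = star V * x * (V * star V) * y * V := by rw [hV]
          _ = _ := by simp [mul_assoc]
      rw [this]; exact mul_mem hx hy
    · intro x _ hx
      have := star_mem hx
      simpa [mul_assoc] using this
  have h2 : IsClosed {x | star V * x * V ∈ B} := hB.preimage hc
  exact closure_minimal h1 h2 hx

lemma star_secondQuant_mul_mem (W : OneParticle ι ≃ₗᵢ[ℂ] OneParticle ι) {A : Fock ι →L[ℂ] Fock ι}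
    (hA : A ∈ carAlgebra ι) : star (secondQuant W) * A * secondQuant W ∈ carAlgebra ι := by
  refine conj_mem_closure (secondQuant_mul_star W) (star_secondQuant_mul W)
    (StarSubalgebra.isClosed_topologicalClosure _) ?_ hA
  rintro _ (⟨φ, rfl⟩ | ⟨φ, rfl⟩)
  · rw [star_secondQuant_mul_create_mul]; exact create_mem _
  · have : star (secondQuant W) * annih φ * secondQuant W = annih (W.symm φ) := by
      have := congrArg star (star_secondQuant_mul_create_mul W φ)
      simp only [star_mul, star_star, ← mul_assoc] at this
      exact this
    rw [this]; exact annih_mem _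

end Algebras

section Tensor

variable (d : ℕ)

/-- The Fock space `𝓕₋(ℓ²(ℤ)) ⊗ 𝓕₋(ℓ²({0, …, d-1}))` of reservoir and sample. The second factor is
finite-dimensional, so that the algebraic tensor product is already complete. -/
def Composite : Type := Fock ℤ ⊗[ℂ] Fock (Fin d)

instance : NormedAddCommGroup (Composite d) :=
  inferInstanceAs (NormedAddCommGroup (Fock ℤ ⊗[ℂ] Fock (Fin d)))

instance : InnerProductSpace ℂ (Composite d) :=
  inferInstanceAs (InnerProductSpace ℂ (Fock ℤ ⊗[ℂ] Fock (Fin d)))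

instance : FiniteDimensional ℂ (Fock (Fin d)) :=
  (lpPiLpₗᵢ (fun _ : Finset (Fin d) ↦ ℂ) ℂ).symm.toLinearEquiv.finiteDimensional

variable {d}

/-- The elementary tensor `x ⊗ y`. -/
def tensorVec (x : Fock ℤ) (y : Fock (Fin d)) : Composite d := x ⊗ₜ[ℂ] y

/-- The operator `A ⊗ B`. -/
def tensorOp (A : Fock ℤ →L[ℂ] Fock ℤ) (B : Fock (Fin d) →L[ℂ] Fock (Fin d)) :
    Composite d →L[ℂ] Composite d := TensorProduct.mapL A B

lemma tensorOp_tensorVec (A : Fock ℤ →L[ℂ] Fock ℤ) (B : Fock (Fin d) →L[ℂ] Fock (Fin d))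
    (x : Fock ℤ) (y : Fock (Fin d)) : tensorOp A B (tensorVec x y) = tensorVec (A x) (B y) := rfl

lemma inner_tensorVec (x x' : Fock ℤ) (y y' : Fock (Fin d)) :
    ⟪tensorVec x y, tensorVec x' y'⟫_ℂ = ⟪x, x'⟫_ℂ * ⟪y, y'⟫_ℂ :=
  TensorProduct.inner_tmul ..

lemma Composite.induction {P : Composite d → Prop} (zero : P 0)
    (tensor : ∀ x y, P (tensorVec x y)) (add : ∀ z w, P z → P w → P (z + w)) (z : Composite d) :
    P z :=
  TensorProduct.induction_on z zero tensor add

lemma tensorOp_mul (A A' : Fock ℤ →L[ℂ] Fock ℤ) (B B' : Fock (Fin d) →L[ℂ] Fock (Fin d)) :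
    tensorOp (A * A') (B * B') = tensorOp A B * tensorOp A' B' :=
  TensorProduct.mapL_mul A A' B B'

lemma tensorOp_one : tensorOp (1 : Fock ℤ →L[ℂ] Fock ℤ) (1 : Fock (Fin d) →L[ℂ] Fock (Fin d)) = 1 :=
  TensorProduct.mapL_id_id

lemma fock_eq_sum (y : Fock (Fin d)) : y = ∑ S, y S • occ S := by
  have h := lp.hasSum_single (p := 2) (by simp) y
  refine h.unique ?_
  convert hasSum_fintype _ using 2 with S
  rw [occ, ← lp.single_smul]; simp

/-- The map `x ⊗ y ↦ y(S) x`. -/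
def sliceVec (S : Finset (Fin d)) : Composite d →L[ℂ] Fock ℤ :=
  show Fock ℤ ⊗[ℂ] Fock (Fin d) →L[ℂ] Fock ℤ from (TensorProduct.ridIsometry ℂ (Fock ℤ)).toContinuousLinearEquiv.toContinuousLinearMap ∘L
    (innerSL ℂ (occ S)).lTensor (Fock ℤ)

lemma sliceVec_tmul (S : Finset (Fin d)) (x : Fock ℤ) (y : Fock (Fin d)) :
    sliceVec S (tensorVec x y) = y S • x := by
  change TensorProduct.ridIsometry ℂ (Fock ℤ) (x ⊗ₜ[ℂ] ⟪occ S, y⟫_ℂ) = _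
  rw [inner_occ]
  simp

/-- The map `x ↦ x ⊗ e_S`, with `e_S` the basis vector of `S`. -/
def slot (S : Finset (Fin d)) : Fock ℤ →L[ℂ] Composite d :=
  show Fock ℤ →L[ℂ] Fock ℤ ⊗[ℂ] Fock (Fin d) from
    (TensorProduct.mkL ℂ (Fock ℤ) (Fock (Fin d))).flip (occ S)

lemma slot_apply (S : Finset (Fin d)) (x : Fock ℤ) : slot S x = tensorVec x (occ S) := rfl

lemma sum_slot_sliceVec (z : Composite d) : ∑ S, slot S (sliceVec S z) = z := by
  induction z using Composite.induction with
  | zero => simp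
  | tensor x y =>
    simp only [sliceVec_tmul, slot_apply]
    have h : ∀ S, tensorVec (y S • x) (occ S) = x ⊗ₜ[ℂ] (y S • occ S) := fun S ↦
      TensorProduct.smul_tmul _ _ _
    simp only [h]
    refine (TensorProduct.tmul_sum x Finset.univ fun S ↦ y S • occ S).symm.trans ?_
    rw [← fock_eq_sum]
    rfl
  | add z w hz hw => simp only [map_add, Finset.sum_add_distrib, hz, hw]

instance : CompleteSpace (Composite d) := by
  refine ⟨fun {l} hl ↦ ?_⟩
  let f : Composite d →L[ℂ] (Finset (Fin d) → Fock ℤ) := ContinuousLinearMap.pi sliceVec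
  let g : (Finset (Fin d) → Fock ℤ) → Composite d := fun x ↦ ∑ S, slot S (x S)
  have hg : Continuous g := by fun_prop
  obtain ⟨y, hy⟩ := CompleteSpace.complete (hl.map f.uniformContinuous)
  refine ⟨g y, ?_⟩
  have hgf : g ∘ f = id := by
    ext1 z; exact sum_slot_sliceVec z
  calc l = Filter.map g (Filter.map f l) := by rw [Filter.map_map, hgf, Filter.map_id]
    _ ≤ Filter.map g (nhds y) := Filter.map_mono hy
    _ ≤ nhds (g y) := hg.tendsto y

lemma adjoint_slot (S : Finset (Fin d)) : ContinuousLinearMap.adjoint (slot S) = sliceVec S := by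
  symm
  rw [ContinuousLinearMap.eq_adjoint_iff]
  intro z x
  induction z using Composite.induction with
  | zero => simp
  | tensor u y =>
    rw [sliceVec_tmul, slot_apply, inner_tensorVec, inner_smul_left,
      ← inner_conj_symm y, inner_occ, mul_comm]
  | add z w hz hw => simp only [map_add, inner_add_left, hz, hw]

/-- The C*-algebra `𝓑 ⊗ 𝓐` of observables of the composite system. -/
def compositeAlgebra (d : ℕ) : StarSubalgebra ℂ (Composite d →L[ℂ] Composite d) :=
  (StarAlgebra.adjoin ℂ {X | ∃ A ∈ carAlgebra ℤ, ∃ B ∈ carAlgebra (Fin d),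
    X = tensorOp A B}).topologicalClosure

lemma tensor_mem {A : Fock ℤ →L[ℂ] Fock ℤ} {B : Fock (Fin d) →L[ℂ] Fock (Fin d)}
    (hA : A ∈ carAlgebra ℤ) (hB : B ∈ carAlgebra (Fin d)) :
    tensorOp A B ∈ compositeAlgebra d :=
  StarSubalgebra.le_topologicalClosure _ (StarAlgebra.subset_adjoin ℂ _ ⟨A, hA, B, hB, rfl⟩)

/-- The operator `b₀^* ⊗ a₀ + b₀ ⊗ a₀^*`. -/
def couplingGenerator (d : ℕ) [NeZero d] : Composite d →L[ℂ] Composite d :=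
  tensorOp (create (site 0)) (annih (site 0)) +
    tensorOp (annih (site 0)) (create (site 0))

/-- The coupling `K = exp(-iα (b₀^* ⊗ a₀ + b₀ ⊗ a₀^*))`. -/
def coupling (d : ℕ) [NeZero d] (α : ℝ) : Composite d →L[ℂ] Composite d :=
  NormedSpace.exp ((-(Complex.I * α)) • couplingGenerator d)

lemma coupling_mem [NeZero d] (α : ℝ) : coupling d α ∈ compositeAlgebra d := by
  have hmem : (-(Complex.I * α)) • couplingGenerator d ∈ compositeAlgebra d :=
    (compositeAlgebra d).smul_mem (add_mem (tensor_mem (create_mem _) (annih_mem _))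
      (tensor_mem (annih_mem _) (create_mem _))) _
  refine (StarSubalgebra.isClosed_topologicalClosure _).mem_of_tendsto
    (NormedSpace.exp_series_hasSum_exp' (𝕂 := ℂ) ((-(Complex.I * α)) • couplingGenerator d))
    (Filter.Eventually.of_forall fun s ↦ ?_)
  exact sum_mem fun n _ ↦ (compositeAlgebra d).smul_mem (pow_mem hmem n) _

/-- The unitary on `ℓ²(ι)` induced by a bijection of the sites (see `permute_site`). -/
def permute {ι : Type} (e : ι ≃ ι) : OneParticle ι ≃ₗᵢ[ℂ] OneParticle ι where
  toFun f := ⟨fun k ↦ f (e.symm k), (memℓp_gen_iff (by simp)).mpr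
    (((memℓp_gen_iff (by simp)).mp (lp.memℓp f)).comp_injective e.symm.injective)⟩
  invFun f := ⟨fun k ↦ f (e k), (memℓp_gen_iff (by simp)).mpr
    (((memℓp_gen_iff (by simp)).mp (lp.memℓp f)).comp_injective e.injective)⟩
  map_add' f g := rfl
  map_smul' c f := rfl
  left_inv f := by ext k; exact congrArg f (e.symm_apply_apply k)
  right_inv f := by ext k; exact congrArg f (e.apply_symm_apply k)
  norm_map' f := by
    rw [lp.norm_eq_tsum_rpow (by simp), lp.norm_eq_tsum_rpow (by simp)]
    congr 1
    exact e.symm.tsum_eq (fun k ↦ ‖f k‖ ^ (2 : ENNReal).toReal)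

lemma permute_site {ι : Type} [LinearOrder ι] (e : ι ≃ ι) (i : ι) :
    permute e (site i) = site (e i) := by
  ext k
  change site i (e.symm k) = site (e i) k
  simp [site, lp.single_apply, Pi.single_apply, Equiv.symm_apply_eq]

/-- The shift on the reservoir, `S Ψ_j = Ψ_{j-1}`. -/
def shift : OneParticle ℤ ≃ₗᵢ[ℂ] OneParticle ℤ := permute (Equiv.subRight 1)

/-- The periodic shift on the sample, `S_p e_j = e_{j-1}`, `S_p e_0 = e_{d-1}`. -/
def periodicShift (d : ℕ) [NeZero d] : OneParticle (Fin d) ≃ₗᵢ[ℂ] OneParticle (Fin d) :=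
  permute (Equiv.subRight 1)

/-- The free one-step dynamics `U_F = Γ(S) ⊗ Γ(W)`. -/
def freeStep (W : OneParticle (Fin d) ≃ₗᵢ[ℂ] OneParticle (Fin d)) :
    Composite d →L[ℂ] Composite d :=
  tensorOp (secondQuant shift) (secondQuant W)

/-- The one-step dynamics `U = U_F K`. -/
def step [NeZero d] (W : OneParticle (Fin d) ≃ₗᵢ[ℂ] OneParticle (Fin d)) (α : ℝ) :
    Composite d →L[ℂ] Composite d := freeStep W * coupling d α

lemma star_tensorOp (A : Fock ℤ →L[ℂ] Fock ℤ) (B : Fock (Fin d) →L[ℂ] Fock (Fin d)) :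
    star (tensorOp A B) = tensorOp (star A) (star B) := by
  rw [ContinuousLinearMap.star_eq_adjoint]
  symm
  rw [ContinuousLinearMap.eq_adjoint_iff]
  intro z w
  induction z using Composite.induction with
  | zero => simp
  | add z z' hz hz' => simp only [map_add, inner_add_left, hz, hz']
  | tensor x y =>
    induction w using Composite.induction with
    | zero => simp
    | add z z' hz hz' => simp only [map_add, inner_add_right, hz, hz']
    | tensor x' y' =>
      simp only [tensorOp_tensorVec, inner_tensorVec, ContinuousLinearMap.star_eq_adjoint,
        ContinuousLinearMap.adjoint_inner_left]

lemma step_conj_mem [NeZero d] (W : OneParticle (Fin d) ≃ₗᵢ[ℂ] OneParticle (Fin d)) (α : ℝ)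
    {X : Composite d →L[ℂ] Composite d} (hX : X ∈ compositeAlgebra d) :
    star (step W α) * X * step W α ∈ compositeAlgebra d := by
  have h : star (freeStep W) * X * freeStep W ∈ compositeAlgebra d := by
    refine conj_mem_closure ?_ ?_ (StarSubalgebra.isClosed_topologicalClosure _) ?_ hX
    · rw [freeStep, star_tensorOp, ← tensorOp_mul, secondQuant_mul_star,
        secondQuant_mul_star]
      exact tensorOp_one
    · rw [freeStep, star_tensorOp, ← tensorOp_mul, star_secondQuant_mul,
        star_secondQuant_mul]
      exact tensorOp_one
    · rintro _ ⟨A, hA, B, hB, rfl⟩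
      rw [freeStep, star_tensorOp, ← tensorOp_mul, ← tensorOp_mul]
      exact tensor_mem (star_secondQuant_mul_mem _ hA) (star_secondQuant_mul_mem _ hB)
  have : star (step W α) * X * step W α =
      star (coupling d α) * (star (freeStep W) * X * freeStep W) * coupling d α := by
    simp [step, mul_assoc]
  rw [this]
  exact mul_mem (mul_mem (star_mem (coupling_mem α)) h) (coupling_mem α)

lemma step_pow_conj_mem [NeZero d] (W : OneParticle (Fin d) ≃ₗᵢ[ℂ] OneParticle (Fin d)) (α : ℝ)
    (t : ℕ) {X : Composite d →L[ℂ] Composite d} (hX : X ∈ compositeAlgebra d) :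
    star (step W α ^ t) * X * step W α ^ t ∈ compositeAlgebra d := by
  induction t with
  | zero => simpa using hX
  | succ t ih =>
    have : star (step W α ^ (t + 1)) * X * step W α ^ (t + 1) =
        star (step W α) * (star (step W α ^ t) * X * step W α ^ t) * step W α := by
      rw [pow_succ, star_mul]; simp [mul_assoc]
    rw [this]
    exact step_conj_mem W α ih

/-- The Heisenberg evolution `τ^t(X) = U^{*t} X U^t`. -/
def evolve [NeZero d] (W : OneParticle (Fin d) ≃ₗᵢ[ℂ] OneParticle (Fin d)) (α : ℝ) (t : ℕ)
    (X : compositeAlgebra d) : compositeAlgebra d :=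
  ⟨star (step W α ^ t) * X * step W α ^ t, step_pow_conj_mem W α t X.2⟩

/-- The partial matrix element of `X` between the sample basis vectors `e_S` and `e_T`, an operator
of the reservoir: `A ⊗ B ↦ ⟨e_S, B e_T⟩ A`. -/
def slice (S T : Finset (Fin d)) (X : Composite d →L[ℂ] Composite d) : Fock ℤ →L[ℂ] Fock ℤ :=
  ContinuousLinearMap.adjoint (slot S) ∘L X ∘L slot T

lemma slice_apply (S T : Finset (Fin d)) (X : Composite d →L[ℂ] Composite d) (x : Fock ℤ) :
    slice S T X x = sliceVec S (X (slot T x)) := by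
  rw [slice, adjoint_slot]; rfl

lemma slice_tensor (S T : Finset (Fin d)) (A : Fock ℤ →L[ℂ] Fock ℤ)
    (B : Fock (Fin d) →L[ℂ] Fock (Fin d)) :
    slice S T (tensorOp A B) = ⟪occ S, B (occ T)⟫_ℂ • A := by
  ext1 x
  rw [slice_apply, slot_apply, tensorOp_tensorVec, sliceVec_tmul, inner_occ]
  rfl

lemma slice_mem (S T : Finset (Fin d)) {X : Composite d →L[ℂ] Composite d}
    (hX : X ∈ compositeAlgebra d) : slice S T X ∈ carAlgebra ℤ := by
  have h1 : ∀ X ∈ StarAlgebra.adjoin ℂ {X | ∃ A ∈ carAlgebra ℤ, ∃ B ∈ carAlgebra (Fin d),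
      X = tensorOp A B}, ∀ S T : Finset (Fin d), slice S T X ∈ carAlgebra ℤ := by
    intro X hX
    refine StarAlgebra.adjoin_induction
      (p := fun X _ ↦ ∀ S T : Finset (Fin d), slice S T X ∈ carAlgebra ℤ) ?_ ?_ ?_ ?_ ?_ hX
    · rintro _ ⟨A, hA, B, hB, rfl⟩ S T
      rw [slice_tensor]
      exact (carAlgebra ℤ).smul_mem hA _
    · intro r S T
      have : algebraMap ℂ (Composite d →L[ℂ] Composite d) r =
          tensorOp (r • (1 : Fock ℤ →L[ℂ] Fock ℤ)) (1 : Fock (Fin d) →L[ℂ] Fock (Fin d)) := by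
        rw [Algebra.algebraMap_eq_smul_one, ← tensorOp_one]
        exact (TensorProduct.mapL_smul_left r _ _).symm
      rw [this, slice_tensor]
      exact (carAlgebra ℤ).smul_mem ((carAlgebra ℤ).smul_mem (one_mem _) _) _
    · intro X Y _ _ hX hY S T
      have : slice S T (X + Y) = slice S T X + slice S T Y := by
        ext1 x; simp [slice_apply]
      rw [this]; exact add_mem (hX S T) (hY S T)
    · intro X Y _ _ hX hY S T
      have : slice S T (X * Y) = ∑ R, slice S R X * slice R T Y := by
        ext1 x
        rw [sum_apply]
        simp only [op_mul_apply, slice_apply]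
        rw [← map_sum, ← map_sum, sum_slot_sliceVec]
      rw [this]
      exact sum_mem fun R _ ↦ mul_mem (hX S R) (hY R T)
    · intro X _ hX S T
      have : slice S T (star X) = star (slice T S X) := by
        simp only [slice, ContinuousLinearMap.star_eq_adjoint, ContinuousLinearMap.adjoint_comp,
          ContinuousLinearMap.adjoint_adjoint]
        rfl
      rw [this]; exact star_mem (hX T S)
  have h2 : IsClosed {X | slice S T X ∈ carAlgebra ℤ} := by
    refine (StarSubalgebra.isClosed_topologicalClosure _).preimage ?_
    unfold slice
    fun_prop
  exact closure_minimal (fun X hX ↦ h1 X hX S T) h2 hX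

/-- The product functional `ω ⊗ ρ`, for a functional `ω` of the reservoir and an operator `ρ` of the
sample (see `productState_tensor`). -/
def productState (ω : carAlgebra ℤ →ₗ[ℂ] ℂ) (ρ : Fock (Fin d) →L[ℂ] Fock (Fin d)) :
    compositeAlgebra d →ₗ[ℂ] ℂ where
  toFun X := ∑ S, ∑ T, ⟪occ T, ρ (occ S)⟫_ℂ * ω ⟨slice S T X, slice_mem S T X.2⟩
  map_add' X Y := by
    simp only [← Finset.sum_add_distrib, ← mul_add, ← map_add]
    refine Finset.sum_congr rfl fun S _ ↦ Finset.sum_congr rfl fun T _ ↦ ?_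
    congr 2
    ext1
    ext1 x
    simp [slice_apply]
  map_smul' c X := by
    simp only [Finset.smul_sum, RingHom.id_apply, ← mul_smul_comm, ← map_smul]
    refine Finset.sum_congr rfl fun S _ ↦ Finset.sum_congr rfl fun T _ ↦ ?_
    congr 2
    ext1
    ext1 x
    simp [slice_apply]

/-- The occupation basis of the Fock space of the sample. -/
def occBasis (d : ℕ) : OrthonormalBasis (Finset (Fin d)) ℂ (Fock (Fin d)) :=
  OrthonormalBasis.ofRepr (lpPiLpₗᵢ (fun _ : Finset (Fin d) ↦ ℂ) ℂ)

lemma occBasis_apply (S : Finset (Fin d)) : occBasis d S = occ S := by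
  refine (occBasis d).repr.injective ?_
  rw [OrthonormalBasis.repr_self]
  ext T
  change _ = occ S T
  rw [occ_apply, PiLp.single_apply]

lemma productState_tensor (ω : carAlgebra ℤ →ₗ[ℂ] ℂ) (ρ : Fock (Fin d) →L[ℂ] Fock (Fin d))
    (A : carAlgebra ℤ) (B : carAlgebra (Fin d)) :
    productState ω ρ ⟨tensorOp A.1 B.1, tensor_mem A.2 B.2⟩ =
      ω A * LinearMap.trace ℂ (Fock (Fin d)) (ρ * B.1 : Fock (Fin d) →L[ℂ] Fock (Fin d)) := by
  rw [LinearMap.trace_eq_sum_inner _ (occBasis d), Finset.mul_sum, productState]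
  simp only [LinearMap.coe_mk, AddHom.coe_mk, occBasis_apply]
  rw [Finset.sum_comm]
  refine Finset.sum_congr rfl fun T _ ↦ ?_
  have h1 : ∀ S, ω ⟨slice S T (tensorOp A.1 B.1), slice_mem S T (tensor_mem A.2 B.2)⟩ =
      ⟪occ S, B.1 (occ T)⟫_ℂ * ω A := by
    intro S
    rw [← smul_eq_mul, ← map_smul]
    congr 1
    exact Subtype.ext (slice_tensor S T A.1 B.1)
  have h2 : B.1 (occ T) = ∑ S, ⟪occ S, B.1 (occ T)⟫_ℂ • occ S := by
    conv_lhs => rw [fock_eq_sum (B.1 (occ T))]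
    simp only [inner_occ]
  have h3 : ⟪occ T, (ρ * B.1) (occ T)⟫_ℂ =
      ∑ S, ⟪occ T, ρ (occ S)⟫_ℂ * ⟪occ S, B.1 (occ T)⟫_ℂ := by
    rw [op_mul_apply]
    conv_lhs => rw [h2]
    simp only [map_sum, map_smul, inner_sum, inner_smul_right]
    exact Finset.sum_congr rfl fun S _ ↦ mul_comm _ _
  refine Eq.trans ?_ (congrArg (ω A * ·) h3.symm)
  simp only [Finset.mul_sum]
  refine Finset.sum_congr rfl fun S _ ↦ ?_
  rw [h1]
  ring

lemma rankOne_occ_mem (S T : Finset (Fin d)) :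
    InnerProductSpace.rankOne ℂ (occ S) (occ T) ∈ carAlgebra (Fin d) := by
  have hV : InnerProductSpace.rankOne ℂ (occ ∅) (occ ∅) ∈ carAlgebra (Fin d) := by
    have h : ∀ l : List (Fin d), ∀ R : Finset (Fin d),
        (l.map fun i ↦ annih (site i) * create (site i)).prod (occ R) =
          if ∃ i ∈ l, i ∈ R then 0 else occ R := by
      intro l R
      induction l with
      | nil => simp
      | cons i l ih =>
        rw [List.map_cons, List.prod_cons, op_mul_apply, ih]
        by_cases h1 : ∃ j ∈ l, j ∈ R
        · have h2 : ∃ j ∈ i :: l, j ∈ R := by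
            obtain ⟨j, hj, hR⟩ := h1; exact ⟨j, List.mem_cons_of_mem _ hj, hR⟩
          rw [if_pos h1, if_pos h2, map_zero]
        · rw [if_neg h1, op_mul_apply, create_site, createSite_occ]
          by_cases h3 : i ∈ R
          · rw [if_pos h3, if_pos ⟨i, by simp, h3⟩, map_zero]
          · have h2 : ¬ ∃ j ∈ i :: l, j ∈ R := by
              rintro ⟨j, hj, hR⟩
              rcases List.mem_cons.mp hj with rfl | hj
              · exact h3 hR
              · exact h1 ⟨j, hj, hR⟩
            rw [if_neg h3, if_neg h2]
            ext Q
            rw [annih, create_site, ← ContinuousLinearMap.star_eq_adjoint, annihSite_apply]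
            by_cases hQ : i ∈ Q
            · have : Q ≠ R := by rintro rfl; exact h3 hQ
              simp [hQ, occ_apply, this]
            · by_cases hQR : Q = R
              · subst hQR
                simp [hQ, occ_apply, wedgeSign_mul_self]
              · have : insert i Q ≠ insert i R := fun h ↦ hQR (by
                  rw [← Finset.erase_insert hQ, h, Finset.erase_insert h3])
                simp [hQ, occ_apply, hQR, this]
    have heq : InnerProductSpace.rankOne ℂ (occ ∅) (occ ∅) =
        ((Finset.univ : Finset (Fin d)).toList.map
          fun i ↦ annih (site i) * create (site i)).prod := by
      refine clm_ext_occ fun R ↦ ?_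
      rw [h, InnerProductSpace.rankOne_apply, inner_occ, occ_apply]
      by_cases hR : R = ∅
      · subst hR; simp
      · obtain ⟨i, hi⟩ := Finset.nonempty_iff_ne_empty.mpr hR
        rw [if_neg (Ne.symm hR), if_pos ⟨i, by simp, hi⟩, zero_smul]
    rw [heq]
    refine list_prod_mem fun x hx ↦ ?_
    obtain ⟨i, -, rfl⟩ := List.mem_map.mp hx
    exact mul_mem (annih_mem _) (create_mem _)
  have hE : ∀ S : Finset (Fin d), ∃ E ∈ carAlgebra (Fin d), E (occ ∅) = occ S := fun S ↦
    ⟨(((S.sort (· ≤ ·)).map site).map create).prod, list_prod_mem fun x hx ↦ by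
      obtain ⟨φ, -, rfl⟩ := List.mem_map.mp hx
      exact create_mem _, elementary_site S⟩
  obtain ⟨E, hE1, hE2⟩ := hE S
  obtain ⟨F, hF1, hF2⟩ := hE T
  have : InnerProductSpace.rankOne ℂ (occ S) (occ T) =
      E * InnerProductSpace.rankOne ℂ (occ ∅) (occ ∅) * star F := by
    ext1 x
    rw [op_mul_apply, op_mul_apply, InnerProductSpace.rankOne_apply,
      InnerProductSpace.rankOne_apply, map_smul, hE2, ← hF2, ContinuousLinearMap.star_eq_adjoint,
      ContinuousLinearMap.adjoint_inner_right]
  rw [this]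
  exact mul_mem (mul_mem hE1 hV) (star_mem hF1)

lemma mem_carAlgebra_fin (A : Fock (Fin d) →L[ℂ] Fock (Fin d)) : A ∈ carAlgebra (Fin d) := by
  have : A = ∑ S, ∑ T, ⟪occ S, A (occ T)⟫_ℂ • InnerProductSpace.rankOne ℂ (occ S) (occ T) := by
    refine clm_ext_occ fun R ↦ ?_
    conv_lhs => rw [fock_eq_sum (A (occ R))]
    simp only [sum_apply, smul_apply, InnerProductSpace.rankOne_apply, inner_occ, occ_apply]
    simp
  rw [this]
  exact sum_mem fun S _ ↦ sum_mem fun T _ ↦ (carAlgebra (Fin d)).smul_mem (rankOne_occ_mem S T) _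

/-- The number operator `N_s = ∑ a_i^* a_i` of the sample. -/
def numberOp (d : ℕ) : Fock (Fin d) →L[ℂ] Fock (Fin d) :=
  ∑ i : Fin d, create (site i) * annih (site i)

/-- The orthogonal projection onto the eigenspace of `N_s` of eigenvalue `p`. -/
def numberProj (d p : ℕ) : Fock (Fin d) →L[ℂ] Fock (Fin d) :=
  (Module.End.eigenspace (numberOp d : Fock (Fin d) →ₗ[ℂ] Fock (Fin d)) (p : ℂ)).starProjection

/-- An observable `A` of the sample, as the observable `1 ⊗ A` of the composite system. -/
def sampleObs (A : Fock (Fin d) →L[ℂ] Fock (Fin d)) : compositeAlgebra d :=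
  ⟨tensorOp 1 A, tensor_mem (one_mem _) (mem_carAlgebra_fin A)⟩

/-- States: positive normalized linear functionals. -/
structure IsState {ι : Type} [LinearOrder ι] (ω : carAlgebra ι →ₗ[ℂ] ℂ) : Prop where
  nonneg : ∀ A, 0 ≤ ω (star A * A)
  map_one : ω 1 = 1

/-- Gauge-invariant quasi-free functionals of density `D`:
`ω(c^*(φ_m) ⋯ c^*(φ_1) c(ψ_1) ⋯ c(ψ_n)) = δ_{mn} det (⟨ψ_j, D φ_k⟩)`. -/
def IsGaugeInvariantQuasiFree {ι : Type} [LinearOrder ι] (ω : carAlgebra ι →ₗ[ℂ] ℂ)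
    (D : OneParticle ι →L[ℂ] OneParticle ι) : Prop :=
  ∀ (m n : ℕ) (φ : Fin m → OneParticle ι) (ψ : Fin n → OneParticle ι),
    ω ((List.ofFn fun i ↦ (⟨create (φ i), create_mem _⟩ : carAlgebra ι)).reverse.prod *
        (List.ofFn fun j ↦ (⟨annih (ψ j), annih_mem _⟩ : carAlgebra ι)).prod) =
      if h : m = n then (Matrix.of fun j k : Fin n ↦ ⟪ψ j, D (φ (Fin.cast h.symm k))⟫_ℂ).det else 0

/-- The probability `(ω ⊗ ρ)(τ^t(1 ⊗ P_p))` of finding `p` particles in the sample at time `t`, for the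
initial states `ω` of the reservoir and `ρ` of the sample. -/
def numberProbability [NeZero d] (ω : carAlgebra ℤ →ₗ[ℂ] ℂ)
    (ρ : Fock (Fin d) →L[ℂ] Fock (Fin d))
    (W : OneParticle (Fin d) ≃ₗᵢ[ℂ] OneParticle (Fin d)) (α : ℝ) (t p : ℕ) : ℂ :=
  productState ω ρ (evolve W α t (sampleObs (numberProj d p)))

end Tensor

end

end QuantumWalk

open QuantumWalk

/-! In the Heisenberg picture an operator of the composite system is a matrix of reservoir
operators, its slices, indexed by pairs of occupation sets of the sample. Conjugation by Γ(S) raises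
every reservoir site by one, and the coupling touches only the reservoir site 0. An observable of
the sample therefore evolves into operators whose slices live on the sites ≥ 0, and on the sites ≥ 1
just before each conjugation by the coupling (`slice_heisenberg_mem`, `slice_freeStep_mem`): the
reservoir mode that meets the sample is always fresh.

For density σ·1 the determinant formula makes distinct sites independent. A number operator at a
fresh site factors out with value σ, and a single creation or annihilation operator at that site
gives 0 (`IsScalarQuasiFree.mul_number` and its companions). The generator G of the coupling
satisfies G³ = G, so the coupling is explicit (`coupling_eq`). In a diagonal slice the interference
terms carry one unpaired operator at site 0 and vanish (`value_slice_coupling`). What remains is a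
closed recursion for the expectations of the diagonal slices, the backward equation of a Markov
chain on subsets of the sample (`value_slice_heisenberg_succ`): with probability sin²α the
occupation of site 0 is replaced by that of a fresh mode, then the sample rotates.

This chain preserves product functions (`productFn_factorStep`). In d steps each factor passes site
0 exactly once (`factorStep_iterate`), so after m periods a site has kept its initial occupation
with probability cos^{2m} α, and is otherwise distributed as a reservoir mode. From the vacuum the
sites are independent, each occupied with probability (1 - cos^{2m} α) σ (`chain_indicator`);
summing over the sets with p elements gives the binomial law (`numberProbability_eq`). -/

namespace QuantumWalk

open scoped lp TensorProduct InnerProductSpace ComplexOrder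

noncomputable section

/-! ### Normal ordering and the local algebras of sets of sites. -/

section Words

variable {ι : Type} [LinearOrder ι]

/-- The product `c^*_{j_m} ⋯ c^*_{j_1}` for the list `j_1, …, j_m` of sites. -/
def createWord (l : List ι) : Fock ι →L[ℂ] Fock ι := (l.map createSite).reverse.prod

/-- The product `c_{j_1} ⋯ c_{j_n}` for the list `j_1, …, j_n` of sites. -/
def annihWord (l : List ι) : Fock ι →L[ℂ] Fock ι := (l.map fun i ↦ star (createSite i)).prod

lemma createWord_cons (i : ι) (l : List ι) :
    createWord (i :: l) = createWord l * createSite i := by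
  simp [createWord]

lemma createWord_concat (i : ι) (l : List ι) :
    createWord (l ++ [i]) = createSite i * createWord l := by
  simp [createWord]

lemma annihWord_cons (i : ι) (l : List ι) :
    annihWord (i :: l) = star (createSite i) * annihWord l := by
  simp [annihWord]

/-- The algebra generated by the creation and annihilation operators of the sites in `J`. -/
def localAlgebra (J : Set ι) : StarSubalgebra ℂ (Fock ι →L[ℂ] Fock ι) :=
  StarAlgebra.adjoin ℂ (createSite '' J)

lemma createSite_mem {J : Set ι} {i : ι} (hi : i ∈ J) : createSite i ∈ localAlgebra J :=
  StarAlgebra.subset_adjoin ℂ _ ⟨i, hi, rfl⟩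

lemma localAlgebra_mono {J J' : Set ι} (h : J ⊆ J') : localAlgebra J ≤ localAlgebra J' :=
  StarAlgebra.adjoin_le (by rintro _ ⟨i, hi, rfl⟩; exact createSite_mem (h hi))

lemma word_mem {J : Set ι} {l l' : List ι} (hl : ∀ i ∈ l, i ∈ J) (hl' : ∀ i ∈ l', i ∈ J) :
    createWord l * annihWord l' ∈ localAlgebra J := by
  refine mul_mem (list_prod_mem fun x hx ↦ ?_) (list_prod_mem fun x hx ↦ ?_)
  · obtain ⟨i, hi, rfl⟩ := List.mem_map.mp (List.mem_reverse.mp hx)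
    exact createSite_mem (hl i hi)
  · obtain ⟨i, hi, rfl⟩ := List.mem_map.mp hx
    exact star_mem (createSite_mem (hl' i hi))

/-- The span of the normally ordered words in the sites of `J`. -/
def normalOrdered (J : Set ι) : Submodule ℂ (Fock ι →L[ℂ] Fock ι) :=
  Submodule.span ℂ {X | ∃ l l' : List ι, (∀ i ∈ l, i ∈ J) ∧ (∀ i ∈ l', i ∈ J) ∧
    X = createWord l * annihWord l'}

lemma createSite_mul_mem_normalOrdered {J : Set ι} {i : ι} (hi : i ∈ J)
    {X : Fock ι →L[ℂ] Fock ι} (hX : X ∈ normalOrdered J) :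
    createSite i * X ∈ normalOrdered J := by
  induction hX using Submodule.span_induction with
  | mem X hX =>
    obtain ⟨l, l', hl, hl', rfl⟩ := hX
    -- `createWord` reverses its list, so multiplying on the left appends at the end.
    refine Submodule.subset_span ⟨l ++ [i], l', ?_, hl', by rw [createWord_concat, mul_assoc]⟩
    intro k hk
    rcases List.mem_append.mp hk with hk | hk
    · exact hl k hk
    · rw [List.mem_singleton.mp hk]; exact hi
  | zero => rw [mul_zero]; exact zero_mem _
  | add X Y _ _ hX hY => rw [mul_add]; exact add_mem hX hY
  | smul r X _ hX => rw [mul_smul_comm]; exact Submodule.smul_mem _ _ hX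

lemma annihSite_mul_createSite (i k : ι) : star (createSite i) * createSite k =
    (if i = k then (1 : ℂ) else 0) • 1 - createSite k * star (createSite i) :=
  eq_sub_of_add_eq (annihSite_createSite i k)

lemma annihSite_anticomm (i j : ι) :
    star (createSite i) * star (createSite j) = -(star (createSite j) * star (createSite i)) := by
  have h := congrArg star (createSite_anticomm i j)
  rw [star_add, star_mul, star_mul, star_zero, add_comm] at h
  exact eq_neg_of_add_eq_zero_left h

/-- The anticommutation relations move the annihilator past the leftmost creator, leaving a shorter
word. That creator is the last entry of `l`, hence the induction from the end of the list. -/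
lemma annihSite_mul_mem_normalOrdered {J : Set ι} {i : ι} (hi : i ∈ J)
    {X : Fock ι →L[ℂ] Fock ι} (hX : X ∈ normalOrdered J) :
    star (createSite i) * X ∈ normalOrdered J := by
  induction hX using Submodule.span_induction with
  | mem X hX =>
    obtain ⟨l, l', hl, hl', rfl⟩ := hX
    induction l using List.reverseRecOn with
    | nil =>
      refine Submodule.subset_span ⟨[], i :: l', by simp, ?_, ?_⟩
      · intro k hk
        rcases List.mem_cons.mp hk with rfl | hk
        exacts [hi, hl' k hk]
      · simp [createWord, annihWord_cons]
    | append_singleton l k ih =>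
      have hl2 : ∀ x ∈ l, x ∈ J := fun x hx ↦ hl x (List.mem_append_left _ hx)
      have hk : k ∈ J := hl k (by simp)
      have h : star (createSite i) * (createWord (l ++ [k]) * annihWord l') =
          (if i = k then (1 : ℂ) else 0) • (createWord l * annihWord l') -
          createSite k * (star (createSite i) * (createWord l * annihWord l')) := by
        rw [createWord_concat, ← mul_assoc, ← mul_assoc, annihSite_mul_createSite]
        simp only [sub_mul, smul_mul_assoc, one_mul, mul_assoc]
      rw [h]
      exact sub_mem (Submodule.smul_mem _ _ (Submodule.subset_span ⟨l, l', hl2, hl', rfl⟩))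
        (createSite_mul_mem_normalOrdered hk (ih hl2))
  | zero => rw [mul_zero]; exact zero_mem _
  | add X Y _ _ hX hY => rw [mul_add]; exact add_mem hX hY
  | smul r X _ hX => rw [mul_smul_comm]; exact Submodule.smul_mem _ _ hX

/-- The span is stable under left multiplication by the generators and their adjoints, and it
contains 1. Carrying `X` and `star X` together lets the induction pass through `star`. -/
lemma localAlgebra_le_normalOrdered {J : Set ι} {X : Fock ι →L[ℂ] Fock ι}
    (hX : X ∈ localAlgebra J) : X ∈ normalOrdered J := by
  have h : ∀ Y ∈ normalOrdered J, X * Y ∈ normalOrdered J ∧ star X * Y ∈ normalOrdered J := by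
    refine StarAlgebra.adjoin_induction (p := fun X _ ↦ ∀ Y ∈ normalOrdered J,
      X * Y ∈ normalOrdered J ∧ star X * Y ∈ normalOrdered J) ?_ ?_ ?_ ?_ ?_ hX
    · rintro _ ⟨i, hi, rfl⟩ Y hY
      exact ⟨createSite_mul_mem_normalOrdered hi hY, annihSite_mul_mem_normalOrdered hi hY⟩
    · intro r Y hY
      simp only [Algebra.algebraMap_eq_smul_one, star_smul, star_one, smul_mul_assoc, one_mul]
      exact ⟨Submodule.smul_mem _ _ hY, Submodule.smul_mem _ _ hY⟩
    · intro A B _ _ hA hB Y hY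
      rw [star_add, add_mul, add_mul]
      exact ⟨add_mem (hA Y hY).1 (hB Y hY).1, add_mem (hA Y hY).2 (hB Y hY).2⟩
    · intro A B _ _ hA hB Y hY
      rw [star_mul, mul_assoc, mul_assoc]
      exact ⟨(hA _ (hB Y hY).1).1, (hB _ (hA Y hY).2).2⟩
    · intro A _ hA Y hY
      rw [star_star]
      exact ⟨(hA Y hY).2, (hA Y hY).1⟩
  have h1 : (1 : Fock ι →L[ℂ] Fock ι) ∈ normalOrdered J :=
    Submodule.subset_span ⟨[], [], by simp, by simp, by simp [createWord, annihWord]⟩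
  simpa using (h 1 h1).1

lemma mul_createWord {X : Fock ι →L[ℂ] Fock ι} {l : List ι}
    (h : ∀ i ∈ l, X * createSite i = -(createSite i * X)) :
    X * createWord l = (-1 : ℂ) ^ l.length • (createWord l * X) := by
  induction l with
  | nil => simp [createWord]
  | cons i l ih =>
    rw [createWord_cons, ← mul_assoc, ih fun k hk ↦ h k (List.mem_cons_of_mem _ hk),
      smul_mul_assoc, mul_assoc, h i (by simp), List.length_cons, pow_succ, mul_smul]
    simp [mul_assoc]

lemma mul_annihWord {X : Fock ι →L[ℂ] Fock ι} {l : List ι}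
    (h : ∀ i ∈ l, X * star (createSite i) = -(star (createSite i) * X)) :
    X * annihWord l = (-1 : ℂ) ^ l.length • (annihWord l * X) := by
  induction l with
  | nil => simp [annihWord]
  | cons i l ih =>
    rw [annihWord_cons, ← mul_assoc, h i (by simp), neg_mul, mul_assoc,
      ih fun k hk ↦ h k (List.mem_cons_of_mem _ hk), List.length_cons, pow_succ, mul_smul]
    simp [mul_assoc]

lemma createSite_mul_annihSite {i j : ι} (h : i ≠ j) :
    createSite i * star (createSite j) = -(star (createSite j) * createSite i) := by
  rw [annihSite_mul_createSite, if_neg h.symm]; simp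

lemma createSite_mul_createSite (i j : ι) :
    createSite i * createSite j = -(createSite j * createSite i) :=
  eq_neg_of_add_eq_zero_left (createSite_anticomm i j)

lemma createSite_sq (j : ι) : createSite j * createSite j = 0 := by
  ext1 x
  rw [op_mul_apply, ← create_site, create_create_self]; rfl

lemma annihSite_sq (j : ι) : star (createSite j) * star (createSite j) = 0 := by
  rw [← star_mul, createSite_sq, star_zero]

lemma createSite_mul_word {j : ι} {l l' : List ι} (h' : j ∉ l') :
    createSite j * (createWord l * annihWord l') =
      (-1 : ℂ) ^ (l.length + l'.length) • (createWord l * annihWord l' * createSite j) := by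
  rw [← mul_assoc, mul_createWord fun i _ ↦ createSite_mul_createSite j i, smul_mul_assoc,
    mul_assoc, mul_annihWord fun i hi ↦ createSite_mul_annihSite (ne_of_mem_of_not_mem hi h').symm, pow_add,
    mul_smul, mul_smul_comm, mul_assoc]

lemma annihSite_mul_word {j : ι} {l l' : List ι} (h : j ∉ l) :
    star (createSite j) * (createWord l * annihWord l') =
      (-1 : ℂ) ^ (l.length + l'.length) • (createWord l * annihWord l' * star (createSite j)) := by
  rw [← mul_assoc, mul_createWord fun i hi ↦ ?_, smul_mul_assoc,
    mul_assoc, mul_annihWord fun i hi ↦ annihSite_anticomm j i, pow_add,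
    mul_smul, mul_smul_comm, mul_assoc]
  rw [createSite_mul_annihSite (ne_of_mem_of_not_mem hi h), neg_neg]

lemma neg_one_pow_smul_smul {E : Type} [AddCommGroup E] [Module ℂ E] (n : ℕ) (x : E) :
    (-1 : ℂ) ^ n • (-1 : ℂ) ^ n • x = x := by
  rw [smul_smul, ← mul_pow]; simp

/-- Both factors of the number operator acquire the sign `(-1) ^ l'.length` on crossing the
annihilators, so no sign is left. In the result `j` heads both lists, ready for a determinant
expansion. -/
lemma word_mul_number {j : ι} {l l' : List ι} (h' : j ∉ l') :
    createWord l * annihWord l' * (createSite j * star (createSite j)) =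
      createWord (j :: l) * annihWord (j :: l') := by
  have h1 : annihWord l' * createSite j = (-1 : ℂ) ^ l'.length • (createSite j * annihWord l') := by
    rw [mul_annihWord fun i hi ↦ createSite_mul_annihSite (ne_of_mem_of_not_mem hi h').symm,
      neg_one_pow_smul_smul]
  have h2 : annihWord l' * star (createSite j) =
      (-1 : ℂ) ^ l'.length • (star (createSite j) * annihWord l') := by
    rw [mul_annihWord fun i hi ↦ annihSite_anticomm j i, neg_one_pow_smul_smul]
  rw [createWord_cons, annihWord_cons, mul_assoc, ← mul_assoc (annihWord l'), h1, smul_mul_assoc,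
    mul_assoc (createSite j), h2, mul_smul_comm, mul_smul_comm, mul_smul_comm,
    neg_one_pow_smul_smul]
  simp only [mul_assoc]

/-- The number operator of a site outside of `J` commutes with the observables of `J`. -/
lemma number_commute {J : Set ι} {j : ι} (hj : j ∉ J) {X : Fock ι →L[ℂ] Fock ι}
    (hX : X ∈ localAlgebra J) :
    createSite j * star (createSite j) * X = X * (createSite j * star (createSite j)) := by
  have hX' := localAlgebra_le_normalOrdered hX
  clear hX
  induction hX' using Submodule.span_induction with
  | mem X hX =>
    obtain ⟨l, l', hl, hl', rfl⟩ := hX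
    -- The creator and the annihilator cross the word with the same sign, so their product crosses
    -- it with none.
    rw [mul_assoc, annihSite_mul_word fun h ↦ hj (hl j h), mul_smul_comm, ← mul_assoc,
      createSite_mul_word fun h ↦ hj (hl' j h), smul_mul_assoc, neg_one_pow_smul_smul, mul_assoc]
  | zero => simp
  | add X Y _ _ hX hY => rw [mul_add, add_mul, hX, hY]
  | smul r X _ hX => rw [mul_smul_comm, smul_mul_assoc, hX]

end Words

/-! ### Independence of distinct sites in a quasi-free state of scalar density. -/

section QuasiFree

variable {ι : Type} [LinearOrder ι]

/-- A purely algebraic extension suffices: only its values on `carAlgebra` enter the result, and it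
frees the calculations from membership proofs. -/
lemma exists_extension (ω : carAlgebra ι →ₗ[ℂ] ℂ) :
    ∃ Ω : (Fock ι →L[ℂ] Fock ι) →ₗ[ℂ] ℂ, ∀ A, ∀ hA : A ∈ carAlgebra ι, Ω A = ω ⟨A, hA⟩ := by
  obtain ⟨Ω, hΩ⟩ := LinearMap.exists_extend (p := (carAlgebra ι).toSubalgebra.toSubmodule) ω
  exact ⟨Ω, fun A hA ↦ LinearMap.congr_fun hΩ ⟨A, hA⟩⟩

/-- The values of a gauge-invariant quasi-free functional of density `σ` on the words in the
operators of the sites. -/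
def IsScalarQuasiFree (Ω : (Fock ι →L[ℂ] Fock ι) →ₗ[ℂ] ℂ) (σ : ℂ) : Prop :=
  ∀ (m n : ℕ) (i : Fin m → ι) (k : Fin n → ι),
    Ω (createWord (List.ofFn i) * annihWord (List.ofFn k)) =
      if h : m = n then
        (Matrix.of fun a b : Fin n ↦ if k a = i (Fin.cast h.symm b) then σ else 0).det else 0

lemma IsGaugeInvariantQuasiFree.isScalarQuasiFree {ω : carAlgebra ι →ₗ[ℂ] ℂ} {σ : ℂ}
    (hq : IsGaugeInvariantQuasiFree ω (σ • ContinuousLinearMap.id ℂ (OneParticle ι)))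
    {Ω : (Fock ι →L[ℂ] Fock ι) →ₗ[ℂ] ℂ} (hΩ : ∀ A, ∀ hA : A ∈ carAlgebra ι, Ω A = ω ⟨A, hA⟩) :
    IsScalarQuasiFree Ω σ := by
  intro m n i k
  have h := hq m n (fun a ↦ site (i a)) (fun a ↦ site (k a))
  rw [← Subtype.coe_eta (_ * _ : carAlgebra ι) (SetLike.coe_mem _), ← hΩ] at h
  have e : (((List.ofFn fun a ↦ (⟨create (site (i a)), create_mem _⟩ : carAlgebra ι)).reverse.prod *
        (List.ofFn fun b ↦ (⟨annih (site (k b)), annih_mem _⟩ : carAlgebra ι)).prod :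
        carAlgebra ι) : Fock ι →L[ℂ] Fock ι) =
      createWord (List.ofFn i) * annihWord (List.ofFn k) := by
    have hc : ∀ l : List (carAlgebra ι), ((l.prod : carAlgebra ι) : Fock ι →L[ℂ] Fock ι) =
        (l.map (carAlgebra ι).subtype).prod := fun l ↦
      map_list_prod (carAlgebra ι).subtype l
    rw [MulMemClass.coe_mul, hc, hc, createWord, annihWord, List.map_reverse, List.map_ofFn,
      List.map_ofFn, List.map_ofFn, List.map_ofFn]
    simp only [Function.comp_def, StarSubalgebra.subtype_apply, create_site, annih, ContinuousLinearMap.star_eq_adjoint]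
  rw [e] at h
  rw [h]
  split_ifs with hmn
  · congr 2
    ext a b
    simp only [smul_apply, ContinuousLinearMap.id_apply, inner_smul_right,
      orthonormal_iff_ite.mp orthonormal_site]
    simp
  · rfl

variable {Ω : (Fock ι →L[ℂ] Fock ι) →ₗ[ℂ] ℂ} {σ : ℂ}

lemma IsScalarQuasiFree.of_length_ne (h : IsScalarQuasiFree Ω σ) {l l' : List ι}
    (hl : l.length ≠ l'.length) : Ω (createWord l * annihWord l') = 0 := by
  have := h _ _ l.get l'.get
  rwa [List.ofFn_get, List.ofFn_get, dif_neg hl] at this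

/-- The row of the determinant that belongs to the annihilator at `j` is zero. -/
lemma IsScalarQuasiFree.cons_right (h : IsScalarQuasiFree Ω σ) {j : ι} {l l' : List ι}
    (hj : j ∉ l) : Ω (createWord l * annihWord (j :: l')) = 0 := by
  have := h _ _ l.get (Fin.cons j l'.get)
  rw [List.ofFn_cons, List.ofFn_get, List.ofFn_get] at this
  rw [this]
  split_ifs with hl
  · refine Matrix.det_eq_zero_of_row_eq_zero 0 fun b ↦ ?_
    rw [Matrix.of_apply, Fin.cons_zero, if_neg]
    rintro rfl
    exact hj (List.get_mem _ _)
  · rfl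

/-- The column of the determinant that belongs to the creator at `j` is zero. -/
lemma IsScalarQuasiFree.cons_left (h : IsScalarQuasiFree Ω σ) {j : ι} {l l' : List ι}
    (hj : j ∉ l') : Ω (createWord (j :: l) * annihWord l') = 0 := by
  have := h _ _ (Fin.cons j l.get) l'.get
  rw [List.ofFn_cons, List.ofFn_get, List.ofFn_get] at this
  rw [this]
  split_ifs with hl
  · refine Matrix.det_eq_zero_of_column_eq_zero (Fin.cast hl 0) fun a ↦ ?_
    rw [Matrix.of_apply, if_neg]
    intro e
    refine hj ?_
    have : l'.get a = j := by simpa using e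
    rw [← this]
    exact List.get_mem _ _
  · rfl

/-- Laplace expansion along the first row, whose only nonzero entry is σ in the corner. If the
lengths differ, both sides vanish. -/
lemma IsScalarQuasiFree.cons_cons (h : IsScalarQuasiFree Ω σ) {j : ι} {l l' : List ι}
    (hj : j ∉ l) : Ω (createWord (j :: l) * annihWord (j :: l')) =
      σ * Ω (createWord l * annihWord l') := by
  by_cases hl : l.length = l'.length
  · obtain ⟨m, i, rfl⟩ : ∃ m, ∃ i : Fin m → ι, l = List.ofFn i := ⟨_, l.get, by simp⟩
    obtain ⟨n, k, rfl⟩ : ∃ n, ∃ k : Fin n → ι, l' = List.ofFn k := ⟨_, l'.get, by simp⟩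
    rw [List.length_ofFn, List.length_ofFn] at hl
    subst hl
    have h1 := h _ _ (Fin.cons j i : Fin (m + 1) → ι) (Fin.cons j k : Fin (m + 1) → ι)
    have h2 := h _ _ i k
    rw [dif_pos rfl] at h1 h2
    rw [List.ofFn_cons, List.ofFn_cons] at h1
    rw [h1, h2, Matrix.det_succ_row_zero, Fin.sum_univ_succ, Finset.sum_eq_zero]
    · simp only [Fin.cast_refl, id, Matrix.of_apply, Fin.cons_zero, if_true, Fin.val_zero, pow_zero,
        one_mul, add_zero]
      congr 2
    · intro b _
      have : j ≠ i b := by rintro rfl; exact hj (by simp [List.mem_ofFn])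
      simp [this]
  · rw [h.of_length_ne hl, h.of_length_ne (by simpa using hl), mul_zero]

/-- A functional of the observables of `J` that vanishes on words vanishes. -/
lemma eq_of_eq_on_words {J : Set ι} {F G : (Fock ι →L[ℂ] Fock ι) →ₗ[ℂ] ℂ}
    (h : ∀ l l' : List ι, (∀ i ∈ l, i ∈ J) → (∀ i ∈ l', i ∈ J) →
      F (createWord l * annihWord l') = G (createWord l * annihWord l'))
    {X : Fock ι →L[ℂ] Fock ι} (hX : X ∈ localAlgebra J) : F X = G X :=
  LinearMap.eqOn_span (f := F) (g := G) (by rintro _ ⟨l, l', hl, hl', rfl⟩; exact h l l' hl hl')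
    (localAlgebra_le_normalOrdered hX)

namespace IsScalarQuasiFree

variable {J : Set ι} {j : ι} {X : Fock ι →L[ℂ] Fock ι}

/-- Independence of the mode `j` from the sites of `J`, checked on normally ordered words, which
span the local algebra. -/
lemma mul_number (hΩ : IsScalarQuasiFree Ω σ) (hj : j ∉ J) (hX : X ∈ localAlgebra J) :
    Ω (X * (createSite j * star (createSite j))) = σ * Ω X := by
  refine eq_of_eq_on_words (F := Ω ∘ₗ LinearMap.mulRight ℂ _) (G := σ • Ω) ?_ hX
  intro l l' hl hl'
  simp only [LinearMap.comp_apply, LinearMap.mulRight_apply, LinearMap.smul_apply, smul_eq_mul]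
  rw [word_mul_number fun h ↦ hj (hl' j h), hΩ.cons_cons fun h ↦ hj (hl j h)]

/-- The creator at `j` has no partner in `X`; moved into normal order, it produces a zero column. -/
lemma mul_createSite (hΩ : IsScalarQuasiFree Ω σ) (hj : j ∉ J) (hX : X ∈ localAlgebra J) :
    Ω (X * createSite j) = 0 := by
  refine eq_of_eq_on_words (F := Ω ∘ₗ LinearMap.mulRight ℂ _) (G := 0) ?_ hX
  intro l l' hl hl'
  have h' : j ∉ l' := fun h ↦ hj (hl' j h)
  have h1 : annihWord l' * createSite j = (-1 : ℂ) ^ l'.length • (createSite j * annihWord l') := by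
    rw [mul_annihWord fun i hi ↦ createSite_mul_annihSite (ne_of_mem_of_not_mem hi h').symm,
      neg_one_pow_smul_smul]
  simp only [LinearMap.comp_apply, LinearMap.mulRight_apply, LinearMap.zero_apply]
  rw [mul_assoc, h1, mul_smul_comm, ← mul_assoc, ← createWord_cons, map_smul,
    hΩ.cons_left h', smul_zero]

lemma mul_annihSite (hΩ : IsScalarQuasiFree Ω σ) (hj : j ∉ J) (hX : X ∈ localAlgebra J) :
    Ω (X * star (createSite j)) = 0 := by
  refine eq_of_eq_on_words (F := Ω ∘ₗ LinearMap.mulRight ℂ _) (G := 0) ?_ hX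
  intro l l' hl hl'
  have h2 : annihWord l' * star (createSite j) =
      (-1 : ℂ) ^ l'.length • (star (createSite j) * annihWord l') := by
    rw [mul_annihWord fun i hi ↦ annihSite_anticomm j i, neg_one_pow_smul_smul]
  simp only [LinearMap.comp_apply, LinearMap.mulRight_apply, LinearMap.zero_apply]
  rw [mul_assoc, h2, mul_smul_comm, ← annihWord_cons, map_smul,
    hΩ.cons_right fun h ↦ hj (hl j h), smul_zero]

lemma createSite_mul (hΩ : IsScalarQuasiFree Ω σ) (hj : j ∉ J) (hX : X ∈ localAlgebra J) :
    Ω (createSite j * X) = 0 := by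
  refine eq_of_eq_on_words (F := Ω ∘ₗ LinearMap.mulLeft ℂ _) (G := 0) ?_ hX
  intro l l' hl hl'
  simp only [LinearMap.comp_apply, LinearMap.mulLeft_apply, LinearMap.zero_apply]
  rw [createSite_mul_word fun h ↦ hj (hl' j h), map_smul, hΩ.mul_createSite hj, smul_zero]
  exact word_mem hl hl'

lemma annihSite_mul (hΩ : IsScalarQuasiFree Ω σ) (hj : j ∉ J) (hX : X ∈ localAlgebra J) :
    Ω (star (createSite j) * X) = 0 := by
  refine eq_of_eq_on_words (F := Ω ∘ₗ LinearMap.mulLeft ℂ _) (G := 0) ?_ hX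
  intro l l' hl hl'
  simp only [LinearMap.comp_apply, LinearMap.mulLeft_apply, LinearMap.zero_apply]
  rw [annihSite_mul_word fun h ↦ hj (hl j h), map_smul, hΩ.mul_annihSite hj, smul_zero]
  exact word_mem hl hl'

/-- Gauge invariance kills the words of unbalanced length, and on balanced ones the sign is +1. So
the sign from moving a single operator across a word is invisible to the functional. -/
lemma smul_word (hΩ : IsScalarQuasiFree Ω σ) (l l' : List ι) :
    (-1 : ℂ) ^ (l.length + l'.length) * Ω (createWord l * annihWord l') =
      Ω (createWord l * annihWord l') := by
  by_cases h : l.length = l'.length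
  · rw [h, ← two_mul, pow_mul]; simp
  · rw [hΩ.of_length_ne h, mul_zero]

lemma createSite_mul_annihSite (hΩ : IsScalarQuasiFree Ω σ) (hj : j ∉ J)
    (hX : X ∈ localAlgebra J) : Ω (createSite j * X * star (createSite j)) = σ * Ω X := by
  refine eq_of_eq_on_words (F := Ω ∘ₗ LinearMap.mulRight ℂ _ ∘ₗ LinearMap.mulLeft ℂ _)
    (G := σ • Ω) ?_ hX
  intro l l' hl hl'
  simp only [LinearMap.comp_apply, LinearMap.mulRight_apply, LinearMap.mulLeft_apply,
    LinearMap.smul_apply, smul_eq_mul]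
  rw [createSite_mul_word fun h ↦ hj (hl' j h), smul_mul_assoc, mul_assoc (_ * _), map_smul,
    hΩ.mul_number hj (word_mem hl hl'), smul_eq_mul, mul_left_comm, hΩ.smul_word]

/-- Moving the annihilator across `X` costs only a sign that `smul_word` removes. What remains is 1
minus the number operator at `j`, which is independent of `X`. -/
lemma annihSite_mul_createSite (hΩ : IsScalarQuasiFree Ω σ) (hj : j ∉ J)
    (hX : X ∈ localAlgebra J) : Ω (star (createSite j) * X * createSite j) = (1 - σ) * Ω X := by
  refine eq_of_eq_on_words (F := Ω ∘ₗ LinearMap.mulRight ℂ _ ∘ₗ LinearMap.mulLeft ℂ _)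
    (G := (1 - σ) • Ω) ?_ hX
  intro l l' hl hl'
  simp only [LinearMap.comp_apply, LinearMap.mulRight_apply, LinearMap.mulLeft_apply,
    LinearMap.smul_apply, smul_eq_mul]
  rw [annihSite_mul_word fun h ↦ hj (hl j h), smul_mul_assoc, mul_assoc (_ * _), map_smul,
    QuantumWalk.annihSite_mul_createSite, if_pos rfl, one_smul, mul_sub, mul_one, map_sub,
    hΩ.mul_number hj (word_mem hl hl'), smul_eq_mul]
  linear_combination (1 - σ) * hΩ.smul_word l l'

end IsScalarQuasiFree

end QuasiFree

/-! ### The exponential of an element G with G³ = G. -/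

section Exponential

variable {A : Type} [NormedRing A] [NormedAlgebra ℂ A] [CompleteSpace A]

lemma exp_smul_idempotent {P : A} (hP : P * P = P) (z : ℂ) :
    NormedSpace.exp (z • P) = 1 + (Complex.exp z - 1) • P := by
  have h1 := NormedSpace.exp_series_hasSum_exp' (𝕂 := ℂ) (z • P)
  -- The series of `exp z • P` has `P` rather than 1 in degree 0; the extra summand `1 - P` corrects
  -- this term.
  have h2 : HasSum (fun n : ℕ ↦ ((n.factorial : ℂ)⁻¹ * z ^ n) • P +
      if n = 0 then 1 - P else 0) (Complex.exp z • P + (1 - P)) := by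
    refine HasSum.add (HasSum.smul_const ?_ P) (hasSum_ite_eq 0 _)
    have := NormedSpace.exp_series_hasSum_exp' (𝕂 := ℂ) z
    rw [← Complex.exp_eq_exp_ℂ] at this
    simpa using this
  have h3 : (fun n : ℕ ↦ ((n.factorial : ℂ)⁻¹ * z ^ n) • P + if n = 0 then 1 - P else 0) =
      fun n : ℕ ↦ (n.factorial : ℂ)⁻¹ • (z • P) ^ n := by
    ext n
    rcases n with _ | n
    · simp
    · have : P ^ (n + 1) = P := IsIdempotentElem.pow_succ_eq n hP
      rw [smul_pow, this, smul_smul]; simp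
  rw [h3] at h2
  rw [h1.unique h2, sub_smul, one_smul]
  abel

/-- `P` and `Q` are the spectral idempotents of `G` for the eigenvalues 1 and -1. They are mutually
orthogonal and G = P - Q, so the exponential splits into two exponentials of idempotents. -/
lemma exp_smul_of_cube {G : A} (hG : G * G * G = G) (z : ℂ) :
    NormedSpace.exp (z • G) = 1 + (Complex.cosh z - 1) • (G * G) + Complex.sinh z • G := by
  have hG4 : G * G * (G * G) = G * G := by rw [← mul_assoc, hG]
  have hG3 : G * (G * G) = G := by rw [← mul_assoc, hG]
  obtain ⟨P, hP⟩ : ∃ P, P = (2⁻¹ : ℂ) • (G * G + G) := ⟨_, rfl⟩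
  obtain ⟨Q, hQ⟩ : ∃ Q, Q = (2⁻¹ : ℂ) • (G * G - G) := ⟨_, rfl⟩
  have hPP : P * P = P := by
    simp only [hP, smul_mul_smul_comm, mul_add, add_mul, hG, hG3, hG4]
    module
  have hQQ : Q * Q = Q := by
    simp only [hQ, smul_mul_smul_comm, mul_sub, sub_mul, hG, hG3, hG4]
    module
  have hPQ : P * Q = 0 := by
    simp only [hP, hQ, smul_mul_smul_comm, mul_sub, add_mul, hG, hG3, hG4]
    module
  have hQP : Q * P = 0 := by
    simp only [hP, hQ, smul_mul_smul_comm, sub_mul, mul_add, hG, hG3, hG4]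
    module
  have hz : z • G = z • P + (-z) • Q := by rw [hP, hQ]; module
  have hc : Commute (z • P) ((-z) • Q) := by
    rw [Commute, SemiconjBy, smul_mul_smul_comm, smul_mul_smul_comm, hPQ, hQP, smul_zero, smul_zero]
  let : NormedAlgebra ℚ A := NormedAlgebra.restrictScalars ℚ ℂ A
  rw [hz, NormedSpace.exp_add_of_commute hc, exp_smul_idempotent hPP, exp_smul_idempotent hQQ,
    mul_add, mul_one, add_mul, one_mul, smul_mul_smul_comm, hPQ, Complex.cosh,
    Complex.sinh, hP, hQ, smul_zero, add_zero]
  module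

end Exponential

/-! ### The coupling in the occupation basis and its effect on expectations. -/

section Coupling

variable {d : ℕ}

lemma annihSite_occ {ι : Type} [LinearOrder ι] (i : ι) (S : Finset ι) :
    star (createSite i) (occ S) = if i ∈ S then wedgeSign i S • occ (S.erase i) else 0 := by
  ext T
  rw [annihSite_apply, occ_apply]
  by_cases hS : i ∈ S
  · by_cases hT : i ∈ T
    · have : T ≠ S.erase i := by rintro rfl; simp at hT
      simp [hS, hT, occ_apply, this]
    · by_cases h : T = S.erase i
      · subst h
        simp [hS, occ_apply, wedgeSign_erase]
      · have : insert i T ≠ S := by rintro rfl; exact h (by simp [hT])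
        simp [hS, hT, this, occ_apply, h]
  · have : insert i T ≠ S := by rintro rfl; simp at hS
    simp [hS, this]

/-- No site of the sample precedes 0, so the coupling brings in no fermionic sign. -/
lemma wedgeSign_zero [NeZero d] (S : Finset (Fin d)) : wedgeSign 0 S = 1 := by
  simp [wedgeSign]

lemma createSite_mul_annihSite_mul_createSite {ι : Type} [LinearOrder ι] (i : ι) :
    createSite i * star (createSite i) * createSite i = createSite i := by
  rw [mul_assoc, annihSite_mul_createSite, if_pos rfl, one_smul, mul_sub, mul_one, ← mul_assoc,
    createSite_sq, zero_mul, sub_zero]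

lemma annihSite_mul_createSite_mul_annihSite {ι : Type} [LinearOrder ι] (i : ι) :
    star (createSite i) * createSite i * star (createSite i) = star (createSite i) := by
  have := congrArg star (createSite_mul_annihSite_mul_createSite i)
  simpa [mul_assoc] using this

lemma tensorOp_zero_left (B : Fock (Fin d) →L[ℂ] Fock (Fin d)) : tensorOp 0 B = 0 := by
  ext1 z
  induction z using Composite.induction with
  | zero => simp
  | tensor x y => rw [tensorOp_tensorVec]; exact TensorProduct.zero_tmul _ _
  | add z w hz hw => rw [map_add, map_add, hz, hw]

lemma tensorVec_zero (x : Fock ℤ) : tensorVec x (0 : Fock (Fin d)) = 0 :=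
  TensorProduct.tmul_zero _ _

lemma inner_slice (S T : Finset (Fin d)) (X : Composite d →L[ℂ] Composite d) (x y : Fock ℤ) :
    ⟪y, slice S T X x⟫_ℂ = ⟪slot S y, X (slot T x)⟫_ℂ := by
  rw [slice, ContinuousLinearMap.comp_apply, ContinuousLinearMap.adjoint_inner_right]
  rfl

lemma inner_star_apply {E : Type} [NormedAddCommGroup E] [InnerProductSpace ℂ E] [CompleteSpace E]
    (A : E →L[ℂ] E) (x y : E) : ⟪y, star A x⟫_ℂ = ⟪A y, x⟫_ℂ :=
  ContinuousLinearMap.adjoint_inner_right _ _ _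

/-- The common calculation for the two halves of a step: the coupling sends a slot into two slots,
the free step into one. -/
lemma slice_conj_of_slot {V : Composite d →L[ℂ] Composite d} {S R S' T Q T' : Finset (Fin d)}
    {u u' w w' : Fock ℤ →L[ℂ] Fock ℤ}
    (hS : ∀ x, V (slot S x) = slot R (u x) + slot S' (w x))
    (hT : ∀ x, V (slot T x) = slot Q (u' x) + slot T' (w' x))
    (Z : Composite d →L[ℂ] Composite d) :
    slice S T (star V * Z * V) = star u * slice R Q Z * u' + star u * slice R T' Z * w' +
      star w * slice S' Q Z * u' + star w * slice S' T' Z * w' := by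
  refine ContinuousLinearMap.ext fun x ↦ ext_inner_left ℂ fun y ↦ ?_
  simp only [inner_slice, op_mul_apply, inner_star_apply, hS, hT, add_apply, inner_add_right,
    inner_add_left, map_add]
  ring

variable [NeZero d]

lemma couplingGenerator_eq : couplingGenerator d =
    tensorOp (createSite 0) (star (createSite 0)) + tensorOp (star (createSite 0)) (createSite 0) := by
  simp only [couplingGenerator, annih, create_site, ContinuousLinearMap.star_eq_adjoint]

/-- Squares of creators and annihilators vanish, so only the alternating triple products survive,
and each of them reduces to its outer factor. -/
lemma couplingGenerator_cube :
    couplingGenerator d * couplingGenerator d * couplingGenerator d = couplingGenerator d := by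
  simp only [couplingGenerator_eq, mul_add, add_mul, ← tensorOp_mul, createSite_sq, annihSite_sq,
    createSite_mul_annihSite_mul_createSite, annihSite_mul_createSite_mul_annihSite,
    tensorOp_zero_left, zero_add, add_zero]
  simp only [mul_assoc, createSite_sq, annihSite_sq, mul_zero, tensorOp_zero_left, zero_add,
    add_zero]

lemma coupling_eq (α : ℝ) : coupling d α = 1 +
    (Complex.cos α - 1) • (couplingGenerator d * couplingGenerator d) +
    (-(Complex.I * Complex.sin α)) • couplingGenerator d := by
  rw [coupling, exp_smul_of_cube couplingGenerator_cube, Complex.cosh_neg, Complex.sinh_neg,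
    mul_comm Complex.I, Complex.cosh_mul_I, Complex.sinh_mul_I, mul_comm (Complex.sin _)]

/-- The set `S` with the site `0` added or removed. -/
def toggle (S : Finset (Fin d)) : Finset (Fin d) := if 0 ∈ S then S.erase 0 else insert 0 S

/-- The reservoir operator that accompanies the change from `S` to `toggle S`. -/
def exchangeOp (S : Finset (Fin d)) : Fock ℤ →L[ℂ] Fock ℤ :=
  if 0 ∈ S then createSite 0 else star (createSite 0)

lemma couplingGenerator_mul_slot (S : Finset (Fin d)) (x : Fock ℤ) :
    couplingGenerator d (slot S x) = slot (toggle S) (exchangeOp S x) := by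
  rw [couplingGenerator_eq, add_apply, slot_apply, tensorOp_tensorVec, tensorOp_tensorVec,
    createSite_occ, annihSite_occ, wedgeSign_zero, toggle, exchangeOp, slot_apply]
  split_ifs <;> simp [tensorVec_zero]

lemma toggle_toggle (S : Finset (Fin d)) : toggle (toggle S) = S := by
  unfold toggle
  split_ifs with h h' h' <;> simp_all

lemma exchangeOp_toggle (S : Finset (Fin d)) : exchangeOp (toggle S) = star (exchangeOp S) := by
  unfold exchangeOp toggle
  split_ifs with h h' h' <;> simp_all

lemma coupling_slot (α : ℝ) (S : Finset (Fin d)) (x : Fock ℤ) :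
    coupling d α (slot S x) =
      slot S ((1 + (Complex.cos α - 1) • (star (exchangeOp S) * exchangeOp S) :
        Fock ℤ →L[ℂ] Fock ℤ) x) +
      slot (toggle S) (((-(Complex.I * Complex.sin α)) • exchangeOp S : Fock ℤ →L[ℂ] Fock ℤ) x) := by
  rw [coupling_eq]
  simp only [add_apply, smul_apply, op_mul_apply, one_apply_eq_self, couplingGenerator_mul_slot,
    toggle_toggle, exchangeOp_toggle, map_add, map_smul]

lemma slice_coupling (α : ℝ) (Z : Composite d →L[ℂ] Composite d) (S T : Finset (Fin d)) :
    slice S T (star (coupling d α) * Z * coupling d α) =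
      star (1 + (Complex.cos α - 1) • (star (exchangeOp S) * exchangeOp S)) * slice S T Z *
        (1 + (Complex.cos α - 1) • (star (exchangeOp T) * exchangeOp T)) +
      star (1 + (Complex.cos α - 1) • (star (exchangeOp S) * exchangeOp S)) * slice S (toggle T) Z *
        ((-(Complex.I * Complex.sin α)) • exchangeOp T) +
      star ((-(Complex.I * Complex.sin α)) • exchangeOp S) * slice (toggle S) T Z *
        (1 + (Complex.cos α - 1) • (star (exchangeOp T) * exchangeOp T)) +
      star ((-(Complex.I * Complex.sin α)) • exchangeOp S) * slice (toggle S) (toggle T) Z *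
        ((-(Complex.I * Complex.sin α)) • exchangeOp T) :=
  slice_conj_of_slot (coupling_slot α S) (coupling_slot α T) Z

lemma exchangeOp_mem (S : Finset (Fin d)) : exchangeOp S ∈ localAlgebra (Set.Ici (0 : ℤ)) := by
  have : createSite 0 ∈ localAlgebra (Set.Ici (0 : ℤ)) := createSite_mem (by simp)
  unfold exchangeOp
  split_ifs
  exacts [this, star_mem this]

/-- The coupling brings in only the reservoir site 0, through `exchangeOp`. -/
lemma slice_coupling_mem (α : ℝ) {Z : Composite d →L[ℂ] Composite d}
    (hZ : ∀ S T, slice S T Z ∈ localAlgebra (Set.Ici (1 : ℤ))) (S T : Finset (Fin d)) :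
    slice S T (star (coupling d α) * Z * coupling d α) ∈ localAlgebra (Set.Ici (0 : ℤ)) := by
  have hZ' : ∀ S T, slice S T Z ∈ localAlgebra (Set.Ici (0 : ℤ)) := fun S T ↦
    localAlgebra_mono (Set.Ici_subset_Ici.mpr zero_le_one) (hZ S T)
  have hu : ∀ S : Finset (Fin d), 1 + (Complex.cos α - 1) • (star (exchangeOp S) * exchangeOp S) ∈
      localAlgebra (Set.Ici (0 : ℤ)) := fun S ↦ add_mem (one_mem _)
    (SMulMemClass.smul_mem _ (mul_mem (star_mem (exchangeOp_mem S)) (exchangeOp_mem S)))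
  have hw : ∀ S : Finset (Fin d), (-(Complex.I * Complex.sin α)) • exchangeOp S ∈
      localAlgebra (Set.Ici (0 : ℤ)) := fun S ↦ SMulMemClass.smul_mem _ (exchangeOp_mem S)
  rw [slice_coupling]
  exact add_mem (add_mem (add_mem
    (mul_mem (mul_mem (star_mem (hu S)) (hZ' _ _)) (hu T))
    (mul_mem (mul_mem (star_mem (hu S)) (hZ' _ _)) (hw T)))
    (mul_mem (mul_mem (star_mem (hw S)) (hZ' _ _)) (hu T)))
    (mul_mem (mul_mem (star_mem (hw S)) (hZ' _ _)) (hw T))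

/-- The expected occupation of the reservoir mode that can be exchanged with the site `0`. -/
def exchangeRate (σ : ℂ) (S : Finset (Fin d)) : ℂ := if 0 ∈ S then 1 - σ else σ

variable {Ω : (Fock ℤ →L[ℂ] Fock ℤ) →ₗ[ℂ] ℂ} {σ : ℂ}

/-- Write B for `exchangeOp S` and n = B*B. The operator n commutes with the slices of `Z`, which do
not involve site 0, and has expectation q, independently of them. The term without exchange gives 1
+ (cos² α - 1) q, the term with two exchanges gives q sin² α, and the two interference terms are
unbalanced in the mode 0 and vanish. -/
lemma value_slice_coupling (hΩ : IsScalarQuasiFree Ω σ) (α : ℝ)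
    {Z : Composite d →L[ℂ] Composite d}
    (hZ : ∀ S T, slice S T Z ∈ localAlgebra (Set.Ici (1 : ℤ))) (S : Finset (Fin d)) :
    Ω (slice S S (star (coupling d α) * Z * coupling d α)) =
      (1 - exchangeRate σ S * Complex.sin α ^ 2) * Ω (slice S S Z) +
      exchangeRate σ S * Complex.sin α ^ 2 * Ω (slice (toggle S) (toggle S) Z) := by
  have h0 : (0 : ℤ) ∉ Set.Ici (1 : ℤ) := by simp
  set B := exchangeOp S with hB
  set q := exchangeRate σ S with hq
  have hBB : B * B = 0 := by
    rw [hB, exchangeOp]; split_ifs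
    exacts [createSite_sq _, annihSite_sq _]
  have hBBs : star B * star B = 0 := by rw [← star_mul, hBB, star_zero]
  have hBBB : star B * B * star B = star B := by
    rw [hB, exchangeOp]; split_ifs
    · exact annihSite_mul_createSite_mul_annihSite _
    · rw [star_star]; exact createSite_mul_annihSite_mul_createSite _
  have hnn : star B * B * (star B * B) = star B * B := by rw [← mul_assoc, hBBB]
  have hac : star (createSite (0 : ℤ)) * createSite 0 = 1 - createSite 0 * star (createSite 0) := by
    rw [annihSite_mul_createSite, if_pos rfl, one_smul]
  -- Here n is the number operator of the reservoir site 0 or 1 minus it.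
  have hcomm : ∀ X ∈ localAlgebra (Set.Ici (1 : ℤ)), star B * B * X = X * (star B * B) := by
    intro X hX
    rw [hB, exchangeOp]; split_ifs
    · rw [hac, sub_mul, mul_sub, number_commute h0 hX, one_mul, mul_one]
    · rw [star_star, number_commute h0 hX]
  have h1 : ∀ X ∈ localAlgebra (Set.Ici (1 : ℤ)), Ω (X * (star B * B)) = q * Ω X := by
    intro X hX
    rw [hB, hq, exchangeOp, exchangeRate]; split_ifs
    · rw [hac, mul_sub, mul_one, map_sub, hΩ.mul_number h0 hX]; ring
    · rw [star_star, hΩ.mul_number h0 hX]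
  have h2 : ∀ X ∈ localAlgebra (Set.Ici (1 : ℤ)), Ω (star B * X * B) = q * Ω X := by
    intro X hX
    rw [hB, hq, exchangeOp, exchangeRate]; split_ifs
    · exact hΩ.annihSite_mul_createSite h0 hX
    · rw [star_star]; exact hΩ.createSite_mul_annihSite h0 hX
  have h3 : ∀ X ∈ localAlgebra (Set.Ici (1 : ℤ)), Ω (X * B) = 0 := by
    intro X hX
    rw [hB, exchangeOp]; split_ifs
    exacts [hΩ.mul_createSite h0 hX, hΩ.mul_annihSite h0 hX]
  have h4 : ∀ X ∈ localAlgebra (Set.Ici (1 : ℤ)), Ω (star B * X) = 0 := by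
    intro X hX
    rw [hB, exchangeOp]; split_ifs
    · exact hΩ.annihSite_mul h0 hX
    · rw [star_star]; exact hΩ.createSite_mul h0 hX
  have hu : star (1 + (Complex.cos α - 1) • (star B * B)) =
      1 + (Complex.cos α - 1) • (star B * B) := by
    rw [star_add, star_one, star_smul, star_mul, star_star]
    congr 2
    rw [star_sub, star_one, Complex.star_def, ← Complex.cos_conj, Complex.conj_ofReal]
  have hw : star ((-(Complex.I * Complex.sin α)) • B) = (Complex.I * Complex.sin α) • star B := by
    rw [star_smul]
    congr 1
    rw [star_neg, star_mul', Complex.star_def, Complex.conj_I, ← Complex.sin_conj,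
      Complex.conj_ofReal]; ring
  rw [slice_coupling, hu, hw]
  rw [map_add, map_add, map_add,
    show (1 + (Complex.cos α - 1) • (star B * B)) * slice S S Z *
        (1 + (Complex.cos α - 1) • (star B * B)) = slice S S Z +
        (Complex.cos α ^ 2 - 1) • (slice S S Z * (star B * B)) from by
      rw [add_mul, one_mul, smul_mul_assoc, hcomm _ (hZ S S), mul_add, mul_one, add_mul,
        mul_smul_comm, smul_mul_assoc, mul_smul_comm, mul_assoc (slice S S Z), hnn]
      module,
    show (1 + (Complex.cos α - 1) • (star B * B)) * slice S (toggle S) Z *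
        ((-(Complex.I * Complex.sin α)) • B) =
        (-(Complex.I * Complex.sin α)) • (slice S (toggle S) Z * B) from by
      rw [add_mul, one_mul, smul_mul_assoc, hcomm _ (hZ S _), add_mul, mul_smul_comm,
        smul_mul_assoc, mul_smul_comm, mul_assoc (slice _ _ _), mul_assoc (star B), hBB]
      simp,
    show ((Complex.I * Complex.sin α) • star B) * slice (toggle S) S Z *
        (1 + (Complex.cos α - 1) • (star B * B)) =
        (Complex.I * Complex.sin α) • (star B * slice (toggle S) S Z) from by
      rw [mul_add, mul_one, mul_smul_comm, smul_mul_assoc, smul_mul_assoc, mul_assoc (star B),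
        ← hcomm _ (hZ _ S), ← mul_assoc, ← mul_assoc, hBBs]
      simp,
    show ((Complex.I * Complex.sin α) • star B) * slice (toggle S) (toggle S) Z *
        ((-(Complex.I * Complex.sin α)) • B) =
        (Complex.sin α ^ 2) • (star B * slice (toggle S) (toggle S) Z * B) from by
      rw [smul_mul_assoc, smul_mul_smul_comm]
      congr 1
      linear_combination (-Complex.sin α ^ 2) * Complex.I_sq,
    map_add, map_smul, map_smul, map_smul, map_smul, h1 _ (hZ _ _), h2 _ (hZ _ _), h3 _ (hZ _ _),
    h4 _ (hZ _ _), smul_zero, smul_zero, smul_eq_mul, smul_eq_mul]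
  linear_combination (q * Ω (slice S S Z)) * Complex.sin_sq_add_cos_sq α

end Coupling

/-! ### The free step: translation of the reservoir and rotation of the sample. -/

section FreeStep

lemma shift_conj_mul (A B : Fock ℤ →L[ℂ] Fock ℤ) :
    star (secondQuant shift) * (A * B) * secondQuant shift =
      star (secondQuant shift) * A * secondQuant shift *
        (star (secondQuant shift) * B * secondQuant shift) := by
  calc _ = star (secondQuant shift) * A * 1 * B * secondQuant shift := by
        simp only [mul_one, mul_assoc]
    _ = _ := by rw [← secondQuant_mul_star shift]; simp only [mul_assoc]

/-- Heisenberg conjugation applies the inverse shift to the one-particle vector, so the site index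
rises. This is what clears site 0 before each coupling. -/
lemma shift_conj_createSite (i : ℤ) :
    star (secondQuant shift) * createSite i * secondQuant shift = createSite (i + 1) := by
  rw [← create_site, star_secondQuant_mul_create_mul, ← create_site]
  congr 1
  rw [LinearIsometryEquiv.symm_apply_eq, shift, permute_site]
  simp

lemma shift_conj_annihSite (i : ℤ) :
    star (secondQuant shift) * star (createSite i) * secondQuant shift =
      star (createSite (i + 1)) := by
  rw [← shift_conj_createSite]
  simp only [star_mul, star_star, mul_assoc]

lemma shift_conj_createWord (l : List ℤ) :
    star (secondQuant shift) * createWord l * secondQuant shift =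
      createWord (l.map (· + 1)) := by
  induction l with
  | nil => simp [createWord, star_secondQuant_mul]
  | cons i l ih =>
    rw [createWord_cons, shift_conj_mul, ih, shift_conj_createSite, List.map_cons, createWord_cons]

lemma shift_conj_annihWord (l : List ℤ) :
    star (secondQuant shift) * annihWord l * secondQuant shift =
      annihWord (l.map (· + 1)) := by
  induction l with
  | nil => simp [annihWord, star_secondQuant_mul]
  | cons i l ih =>
    rw [annihWord_cons, shift_conj_mul, ih, shift_conj_annihSite, List.map_cons, annihWord_cons]

lemma shift_conj_mem {X : Fock ℤ →L[ℂ] Fock ℤ} (hX : X ∈ localAlgebra (Set.Ici (0 : ℤ))) :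
    star (secondQuant shift) * X * secondQuant shift ∈ localAlgebra (Set.Ici (1 : ℤ)) := by
  have hX' := localAlgebra_le_normalOrdered hX
  clear hX
  have hmap : ∀ l : List ℤ, (∀ i ∈ l, i ∈ Set.Ici (0 : ℤ)) →
      ∀ i ∈ l.map (· + 1), i ∈ Set.Ici (1 : ℤ) := by
    intro l hl i hi
    obtain ⟨k, hk, rfl⟩ := List.mem_map.mp hi
    have : 0 ≤ k := hl k hk
    exact Set.mem_Ici.mpr (by omega)
  induction hX' using Submodule.span_induction with
  | mem X hX =>
    obtain ⟨l, l', hl, hl', rfl⟩ := hX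
    rw [shift_conj_mul, shift_conj_createWord, shift_conj_annihWord]
    exact word_mem (hmap l hl) (hmap l' hl')
  | zero => simp
  | add X Y _ _ hX hY => rw [mul_add, add_mul]; exact add_mem hX hY
  | smul r X _ hX => rw [mul_smul_comm, smul_mul_assoc]; exact SMulMemClass.smul_mem _ hX

/-- The determinant depends only on which sites coincide, and translation is injective. -/
lemma IsScalarQuasiFree.shift_conj {Ω : (Fock ℤ →L[ℂ] Fock ℤ) →ₗ[ℂ] ℂ} {σ : ℂ}
    (hΩ : IsScalarQuasiFree Ω σ) {J : Set ℤ} {X : Fock ℤ →L[ℂ] Fock ℤ}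
    (hX : X ∈ localAlgebra J) :
    Ω (star (secondQuant shift) * X * secondQuant shift) = Ω X := by
  refine eq_of_eq_on_words (F := Ω ∘ₗ LinearMap.mulRight ℂ _ ∘ₗ LinearMap.mulLeft ℂ _)
    (G := Ω) ?_ hX
  intro l l' _ _
  simp only [LinearMap.comp_apply, LinearMap.mulRight_apply, LinearMap.mulLeft_apply]
  rw [shift_conj_mul, shift_conj_createWord, shift_conj_annihWord]
  have h1 := hΩ _ _ l.get l'.get
  have h2 := hΩ _ _ (fun a ↦ l.get a + 1) (fun a ↦ l'.get a + 1)
  have e : ∀ l : List ℤ, List.ofFn (fun a ↦ l.get a + 1) = l.map (· + 1) := fun l ↦ by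
    conv_rhs => rw [← List.ofFn_get l, List.map_ofFn]
    rfl
  rw [e, e] at h2
  rw [List.ofFn_get, List.ofFn_get] at h1
  rw [h1, h2]
  simp

variable {d : ℕ}

/-- Permuting the sites leaves the wedge product out of order, and sorting it costs a sign. Only its
modulus matters below. -/
lemma secondQuant_permute_occ {ι : Type} [LinearOrder ι] (e : ι ≃ ι) (S : Finset ι) :
    ∃ ε : ℂ, star ε * ε = 1 ∧
      secondQuant (permute e) (occ S) = ε • occ (S.map e.toEmbedding) := by
  induction S using Finset.induction_on with
  | empty =>
    refine ⟨1, by simp, ?_⟩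
    have := secondQuant_elementary (permute e) []
    simpa [elementary_nil, vacuum] using this
  | insert i S hi ih =>
    obtain ⟨ε, hε, h⟩ := ih
    have h1 : occ (insert i S) = wedgeSign i S • createSite i (occ S) := by
      rw [createSite_occ, if_neg hi, smul_smul, wedgeSign_mul_self, one_smul]
    refine ⟨wedgeSign i S * (ε * wedgeSign (e i) (S.map e.toEmbedding)), ?_, ?_⟩
    · have h2 := wedgeSign_mul_self i S
      have h3 := wedgeSign_mul_self (e i) (S.map e.toEmbedding)
      simp only [star_mul', Complex.star_def, star_wedgeSign] at hε ⊢
      linear_combination (wedgeSign i S * wedgeSign i S *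
        (wedgeSign (e i) (S.map e.toEmbedding) * wedgeSign (e i) (S.map e.toEmbedding))) * hε +
        (wedgeSign i S * wedgeSign i S) * h3 + h2
    · rw [h1, map_smul, ← create_site, ← op_mul_apply, secondQuant_mul_create, op_mul_apply, h,
        permute_site, create_site, map_smul, createSite_occ, if_neg (by simpa using hi),
        Finset.map_insert, smul_smul, smul_smul, mul_assoc]
      rfl

variable [NeZero d]

/-- The set of sites `S` moved by the periodic shift. -/
def rotate (S : Finset (Fin d)) : Finset (Fin d) := S.map (Equiv.subRight 1).toEmbedding

lemma mem_rotate (S : Finset (Fin d)) (i : Fin d) : i ∈ rotate S ↔ i + 1 ∈ S := by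
  rw [rotate, Finset.mem_map_equiv]
  simp

/-- The vanishing second summand gives the formula the shape that `slice_conj_of_slot` expects. -/
lemma freeStep_slot (S : Finset (Fin d)) : ∃ ε : ℂ, star ε * ε = 1 ∧
    ∀ x, freeStep (periodicShift d) (slot S x) =
      slot (rotate S) ((ε • secondQuant shift : Fock ℤ →L[ℂ] Fock ℤ) x) +
      slot S ((0 : Fock ℤ →L[ℂ] Fock ℤ) x) := by
  obtain ⟨ε, hε, h⟩ := secondQuant_permute_occ (Equiv.subRight (1 : Fin d)) S
  refine ⟨ε, hε, fun x ↦ ?_⟩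
  rw [freeStep, slot_apply, tensorOp_tensorVec, periodicShift, h, smul_apply, zero_apply, map_zero,
    add_zero, slot_apply, rotate]
  exact TensorProduct.tmul_smul ..

/-- The phases of the two slots cancel on the diagonal. Off the diagonal a phase remains, but there
only membership in a local algebra is needed. -/
lemma slice_freeStep (Z : Composite d →L[ℂ] Composite d) (S T : Finset (Fin d)) :
    ∃ c : ℂ, (S = T → c = 1) ∧
      slice S T (star (freeStep (periodicShift d)) * Z * freeStep (periodicShift d)) =
        c • (star (secondQuant shift) * slice (rotate S) (rotate T) Z * secondQuant shift) := by
  by_cases hST : S = T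
  · subst hST
    obtain ⟨ε, hε, h⟩ := freeStep_slot S
    refine ⟨1, fun _ ↦ rfl, ?_⟩
    rw [slice_conj_of_slot h h]
    simp only [star_zero, mul_zero, zero_mul, add_zero, star_smul, smul_mul_assoc, mul_smul_comm,
      smul_smul, smul_zero, add_zero]
    rw [mul_comm, hε]
  · obtain ⟨ε, hε, h⟩ := freeStep_slot S
    obtain ⟨ε', hε', h'⟩ := freeStep_slot T
    refine ⟨ε' * star ε, fun h ↦ absurd h hST, ?_⟩
    rw [slice_conj_of_slot h h']
    simp only [star_zero, mul_zero, zero_mul, add_zero, star_smul, smul_mul_assoc, mul_smul_comm,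
      smul_smul, smul_zero, add_zero]

end FreeStep

/-! ### The recursion for the diagonal slices. -/

section Evolution

variable {d : ℕ} [NeZero d]

lemma step_conj_eq (α : ℝ) (X : Composite d →L[ℂ] Composite d) :
    star (step (periodicShift d) α) * X * step (periodicShift d) α =
      star (coupling d α) * (star (freeStep (periodicShift d)) * X *
        freeStep (periodicShift d)) * coupling d α := by
  simp [step, mul_assoc]

lemma slice_freeStep_mem {X : Composite d →L[ℂ] Composite d}
    (hX : ∀ S T, slice S T X ∈ localAlgebra (Set.Ici (0 : ℤ))) (S T : Finset (Fin d)) :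
    slice S T (star (freeStep (periodicShift d)) * X * freeStep (periodicShift d)) ∈
      localAlgebra (Set.Ici (1 : ℤ)) := by
  obtain ⟨c, -, h⟩ := slice_freeStep X S T
  rw [h]
  exact SMulMemClass.smul_mem _ (shift_conj_mem (hX _ _))

/-- The `t`-step Heisenberg evolution of an operator. -/
def heisenberg (α : ℝ) (X : Composite d →L[ℂ] Composite d) (t : ℕ) :
    Composite d →L[ℂ] Composite d :=
  star (step (periodicShift d) α ^ t) * X * step (periodicShift d) α ^ t

lemma heisenberg_succ (α : ℝ) (X : Composite d →L[ℂ] Composite d) (t : ℕ) :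
    heisenberg α X (t + 1) = star (coupling d α) * (star (freeStep (periodicShift d)) *
      heisenberg α X t * freeStep (periodicShift d)) * coupling d α := by
  rw [← step_conj_eq, heisenberg, heisenberg, pow_succ, star_mul]
  simp only [mul_assoc]

/-- The invariant of the evolution: the free step moves the slices from the sites ≥ 0 to the sites ≥
1, and the coupling then brings site 0 back. -/
lemma slice_heisenberg_mem (α : ℝ) {X : Composite d →L[ℂ] Composite d}
    (hX : ∀ S T, slice S T X ∈ localAlgebra (Set.Ici (0 : ℤ))) (t : ℕ) (S T : Finset (Fin d)) :
    slice S T (heisenberg α X t) ∈ localAlgebra (Set.Ici (0 : ℤ)) := by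
  induction t generalizing S T with
  | zero => simpa [heisenberg] using hX S T
  | succ t ih =>
    rw [heisenberg_succ]
    exact slice_coupling_mem α (slice_freeStep_mem ih) S T

/-- The occupation probabilities evolve by a classical Markov chain. -/
lemma value_slice_heisenberg_succ {Ω : (Fock ℤ →L[ℂ] Fock ℤ) →ₗ[ℂ] ℂ} {σ : ℂ}
    (hΩ : IsScalarQuasiFree Ω σ) (α : ℝ) {X : Composite d →L[ℂ] Composite d}
    (hX : ∀ S T, slice S T X ∈ localAlgebra (Set.Ici (0 : ℤ))) (t : ℕ) (S : Finset (Fin d)) :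
    Ω (slice S S (heisenberg α X (t + 1))) =
      (1 - exchangeRate σ S * Complex.sin α ^ 2) *
        Ω (slice (rotate S) (rotate S) (heisenberg α X t)) +
      exchangeRate σ S * Complex.sin α ^ 2 *
        Ω (slice (rotate (toggle S)) (rotate (toggle S)) (heisenberg α X t)) := by
  have h : ∀ S : Finset (Fin d), Ω (slice S S (star (freeStep (periodicShift d)) *
      heisenberg α X t * freeStep (periodicShift d))) =
      Ω (slice (rotate S) (rotate S) (heisenberg α X t)) := by
    intro S
    obtain ⟨c, hc, h⟩ := slice_freeStep (heisenberg α X t) S S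
    rw [h, hc rfl, one_smul, hΩ.shift_conj (slice_heisenberg_mem α hX t _ _)]
  rw [heisenberg_succ, value_slice_coupling hΩ α
    (slice_freeStep_mem (slice_heisenberg_mem α hX t)), h, h]

end Evolution

/-! ### Exact solution of the classical Markov chain. -/

section Chain

/-- The one-site Markov operator: with probability `s` the occupation is replaced by that of a
reservoir mode of density `σ`. -/
def mix (σ s : ℂ) (φ : Bool → ℂ) : Bool → ℂ := fun b ↦
  (1 - s) * φ b + s * (σ * φ true + (1 - σ) * φ false)

/-- The average of φ over the reservoir law is fixed by `mix`, and the deviation from it shrinks by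
the factor 1 - s. -/
lemma mix_iterate (σ s : ℂ) (φ : Bool → ℂ) (m : ℕ) (b : Bool) :
    (mix σ s)^[m] φ b =
      (1 - s) ^ m * φ b + (1 - (1 - s) ^ m) * (σ * φ true + (1 - σ) * φ false) := by
  induction m generalizing b with
  | zero => simp
  | succ m ih => rw [Function.iterate_succ_apply', mix, ih, ih, ih]; ring

variable {d : ℕ} [NeZero d]

/-- The product function of the occupation numbers of the sites. -/
def productFn (φ : Fin d → Bool → ℂ) (S : Finset (Fin d)) : ℂ := ∏ i, φ i (decide (i ∈ S))

/-- One step of the chain on the factors of a product function. -/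
def factorStep (σ s : ℂ) (φ : Fin d → Bool → ℂ) : Fin d → Bool → ℂ := fun i ↦
  if i = 0 then mix σ s (φ (i - 1)) else φ (i - 1)

lemma productFn_rotate (φ : Fin d → Bool → ℂ) (S : Finset (Fin d)) :
    productFn φ (rotate S) = productFn (fun i ↦ φ (i - 1)) S := by
  unfold productFn
  rw [← Equiv.prod_comp (Equiv.addRight (1 : Fin d)) fun i ↦ φ (i - 1) (decide (i ∈ S))]
  refine Finset.prod_congr rfl fun i _ ↦ ?_
  congr 1
  · simp
  · exact decide_eq_decide.mpr (by rw [mem_rotate]; rfl)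

/-- The two terms differ only in the factor at site 0. There the flip rates, (1 - σ) s when occupied
and σ s when empty, add up to `mix`. -/
lemma productFn_factorStep (σ s : ℂ) (φ : Fin d → Bool → ℂ) (S : Finset (Fin d)) :
    productFn (factorStep σ s φ) S =
      (1 - exchangeRate σ S * s) * productFn φ (rotate S) +
      exchangeRate σ S * s * productFn φ (rotate (toggle S)) := by
  rw [productFn_rotate, productFn_rotate]
  unfold productFn
  rw [Fintype.prod_eq_mul_prod_compl 0, Fintype.prod_eq_mul_prod_compl 0,
    Fintype.prod_eq_mul_prod_compl 0]
  have h1 : ∏ i ∈ {0}ᶜ, factorStep σ s φ i (decide (i ∈ S)) =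
      ∏ i ∈ {0}ᶜ, φ (i - 1) (decide (i ∈ S)) :=
    Finset.prod_congr rfl fun i hi ↦ by
      rw [factorStep, if_neg (by simpa using hi)]
  have h2 : ∏ i ∈ {0}ᶜ, φ (i - 1) (decide (i ∈ toggle S)) =
      ∏ i ∈ {0}ᶜ, φ (i - 1) (decide (i ∈ S)) :=
    Finset.prod_congr rfl fun i hi ↦ by
      have hi : i ≠ 0 := by simpa using hi
      congr 1
      unfold toggle
      split_ifs <;> simp [hi]
  rw [h1, h2]
  by_cases h0 : (0 : Fin d) ∈ S
  · simp [factorStep, mix, exchangeRate, toggle, h0]; ring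
  · simp [factorStep, mix, exchangeRate, toggle, h0]; ring

lemma val_sub_one (i : Fin d) : ((i - 1 : Fin d) : ℕ) = if i = 0 then d - 1 else i.val - 1 := by
  obtain _ | n := d
  · exact i.elim0
  · exact Fin.coe_sub_one i

/-- After t ≤ d steps the factor at `i` comes from the site i - t. It has been mixed, and only once,
exactly when its path has reached site 0. -/
lemma factorStep_iterate (σ s : ℂ) (φ : Fin d → Bool → ℂ) {t : ℕ} (ht : t ≤ d) (i : Fin d) :
    (factorStep σ s)^[t] φ i =
      if i.val < t then mix σ s (φ (i - t • 1)) else φ (i - t • 1) := by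
  induction t generalizing i with
  | zero => simp
  | succ t ih =>
    have hsub : i - 1 - t • 1 = i - (t + 1) • (1 : Fin d) := by rw [succ_nsmul']; abel
    rw [Function.iterate_succ_apply', factorStep, ih (by omega), hsub, val_sub_one]
    by_cases h0 : i = 0
    · subst h0
      -- The factor arriving at 0 comes from the site d - 1, which is not yet mixed because t ≤ d -
      -- 1.
      rw [if_pos rfl, if_pos rfl, if_neg (by omega), if_pos (by simp)]
    · have : i.val ≠ 0 := fun h ↦ h0 (Fin.ext (by simpa using h))
      rw [if_neg h0, if_neg h0]
      congr 1
      exact propext (by omega)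

lemma period_nsmul_one : d • (1 : Fin d) = 0 := by
  simpa using card_nsmul_eq_zero (x := (1 : Fin d))

lemma factorStep_iterate_period (σ s : ℂ) (φ : Fin d → Bool → ℂ) (m : ℕ) (i : Fin d) :
    (factorStep σ s)^[m * d] φ i = (mix σ s)^[m] (φ i) := by
  induction m generalizing i with
  | zero => simp
  | succ m ih =>
    rw [add_mul, one_mul, add_comm, Function.iterate_add_apply, factorStep_iterate _ _ _ le_rfl,
      if_pos i.isLt, Function.iterate_succ_apply', period_nsmul_one, sub_zero, ih]

lemma chain_solution {g : ℕ → Finset (Fin d) → ℂ} {σ s : ℂ}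
    (hg : ∀ t S, g (t + 1) S = (1 - exchangeRate σ S * s) * g t (rotate S) +
      exchangeRate σ S * s * g t (rotate (toggle S)))
    {φ : Fin d → Bool → ℂ} (h0 : ∀ S, g 0 S = productFn φ S) (t : ℕ) (S : Finset (Fin d)) :
    g t S = productFn ((factorStep σ s)^[t] φ) S := by
  induction t generalizing S with
  | zero => exact h0 S
  | succ t ih =>
    rw [hg, ih, ih, Function.iterate_succ_apply', productFn_factorStep]

/-- Started from the empty sample, after `m` periods the sites are independent and each is occupied
with probability `(1 - (1 - s) ^ m) σ`. -/
lemma chain_indicator {g : ℕ → Finset (Fin d) → ℂ} {σ s : ℂ}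
    (hg : ∀ t S, g (t + 1) S = (1 - exchangeRate σ S * s) * g t (rotate S) +
      exchangeRate σ S * s * g t (rotate (toggle S)))
    {R : Finset (Fin d)} (h0 : ∀ S, g 0 S = if S = R then 1 else 0) (m : ℕ) :
    g (m * d) ∅ = ((1 - (1 - s) ^ m) * σ) ^ R.card *
      (1 - (1 - (1 - s) ^ m) * σ) ^ (d - R.card) := by
  -- The indicator of `R` is the product over the sites of the indicators of agreement with `R`.
  have h1 : ∀ S, g 0 S = productFn (fun i b ↦ if b = decide (i ∈ R) then 1 else 0) S := by
    intro S
    rw [h0, productFn, Finset.prod_ite_zero]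
    simp [Finset.ext_iff]
  rw [chain_solution hg h1, productFn]
  simp only [factorStep_iterate_period, mix_iterate, Finset.notMem_empty, decide_false]
  -- Every factor is evaluated at `false`, since the sample starts empty.
  have h2 : ∀ i : Fin d, ((1 - s) ^ m * (if false = decide (i ∈ R) then 1 else 0) +
      (1 - (1 - s) ^ m) * (σ * (if true = decide (i ∈ R) then 1 else 0) +
        (1 - σ) * (if false = decide (i ∈ R) then 1 else 0))) =
      if i ∈ R then (1 - (1 - s) ^ m) * σ else 1 - (1 - (1 - s) ^ m) * σ := by
    intro i
    by_cases hi : i ∈ R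
    · simp [hi]
    · simp [hi]; ring
  rw [Finset.prod_congr rfl fun i _ ↦ h2 i, Finset.prod_ite, Finset.prod_const, Finset.prod_const]
  congr 2
  · simp
  · rw [Finset.filter_not, Finset.card_sdiff_of_subset (by simp)]; simp

end Chain

/-! ### Spectral decomposition of the number operator and the binomial law. -/

section NumberDistribution

variable {d : ℕ}

lemma numberOp_occ (S : Finset (Fin d)) : numberOp d (occ S) = (S.card : ℂ) • occ S := by
  have h : ∀ i : Fin d, (create (site i) * annih (site i)) (occ S) =
      (if i ∈ S then (1 : ℂ) else 0) • occ S := by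
    intro i
    rw [op_mul_apply, annih, create_site, ← ContinuousLinearMap.star_eq_adjoint, annihSite_occ]
    split_ifs with hi
    · rw [map_smul, createSite_occ, if_neg (by simp), Finset.insert_erase hi, smul_smul,
        wedgeSign_erase hi, if_neg (lt_irrefl _), one_mul, wedgeSign_mul_self]
    · simp
  rw [numberOp, sum_apply, Finset.sum_congr rfl fun i _ ↦ h i, ← Finset.sum_smul]
  simp

lemma numberOp_apply (v : Fock (Fin d)) (S : Finset (Fin d)) :
    numberOp d v S = S.card * v S := by
  conv_lhs => rw [fock_eq_sum v]
  rw [map_sum, ← inner_occ, inner_sum]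
  simp only [map_smul, numberOp_occ, inner_smul_right, inner_occ, occ_apply]
  simp [mul_comm]

/-- The number operator is diagonal in the occupation basis: a basis vector with p particles lies in
the eigenspace, and any other is orthogonal to it because eigenvectors have zero coordinate there.
-/
lemma numberProj_eq (p : ℕ) : numberProj d p =
    ∑ R ∈ Finset.univ.filter fun R : Finset (Fin d) ↦ R.card = p,
      InnerProductSpace.rankOne ℂ (occ R) (occ R) := by
  refine clm_ext_occ fun S ↦ ?_
  have h : (∑ R ∈ Finset.univ.filter fun R : Finset (Fin d) ↦ R.card = p,
      InnerProductSpace.rankOne ℂ (occ R) (occ R)) (occ S) =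
      if S.card = p then occ S else 0 := by
    rw [sum_apply]
    simp only [InnerProductSpace.rankOne_apply, inner_occ, occ_apply]
    simp
  rw [h, numberProj]
  split_ifs with hS
  · refine Submodule.starProjection_eq_self_iff.mpr ?_
    rw [Module.End.mem_eigenspace_iff, ← hS]
    exact numberOp_occ S
  · refine (Submodule.starProjection_apply_eq_zero_iff _).mpr ?_
    rw [Submodule.mem_orthogonal']
    intro v hv
    rw [Module.End.mem_eigenspace_iff] at hv
    have h1 : (S.card : ℂ) * v S = p * v S := by
      rw [← numberOp_apply]
      exact congrArg (fun w : Fock (Fin d) ↦ w S) hv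
    rw [inner_occ]
    have h2 : (S.card : ℂ) - p ≠ 0 := sub_ne_zero.mpr (by exact_mod_cast hS)
    exact (mul_eq_zero.mp (by linear_combination h1 : ((S.card : ℂ) - p) * v S = 0)).resolve_left h2

lemma productState_vacuum (ω : carAlgebra ℤ →ₗ[ℂ] ℂ) (X : compositeAlgebra d) :
    productState ω (InnerProductSpace.rankOne ℂ vacuum vacuum) X =
      ω ⟨slice ∅ ∅ (X : Composite d →L[ℂ] Composite d), slice_mem ∅ ∅ X.2⟩ := by
  change ∑ S, ∑ T, ⟪occ T, InnerProductSpace.rankOne ℂ (occ ∅) (occ ∅) (occ S)⟫_ℂ *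
    ω ⟨slice S T (X : Composite d →L[ℂ] Composite d), slice_mem S T X.2⟩ = _
  have h : ∀ S T : Finset (Fin d),
      ⟪occ T, InnerProductSpace.rankOne ℂ (occ ∅) (occ ∅) (occ S)⟫_ℂ =
      if S = ∅ then (if T = ∅ then 1 else 0) else 0 := by
    intro S T
    rw [InnerProductSpace.rankOne_apply, inner_smul_right, inner_occ, inner_occ, occ_apply,
      occ_apply]
    split_ifs <;> simp_all
  simp only [h]
  rw [Finset.sum_eq_single ∅ (fun S _ hS ↦ by simp [hS]) (by simp),
    Finset.sum_eq_single ∅ (fun T _ hT ↦ by simp [hT]) (by simp)]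
  simp

lemma tensorOp_sum {β : Type} (s : Finset β) (B : β → Fock (Fin d) →L[ℂ] Fock (Fin d)) :
    tensorOp 1 (∑ i ∈ s, B i) = ∑ i ∈ s, tensorOp 1 (B i) := by
  ext1 z
  induction z using Composite.induction with
  | zero => simp
  | tensor x y =>
    simp only [sum_apply, tensorOp_tensorVec]
    exact TensorProduct.tmul_sum ..
  | add z w hz hw => rw [map_add, map_add, hz, hw]

lemma slice_occProj (R S T : Finset (Fin d)) :
    slice S T (tensorOp 1 (InnerProductSpace.rankOne ℂ (occ R) (occ R))) =
      ((if S = R then (1 : ℂ) else 0) * if T = R then 1 else 0) • 1 := by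
  rw [slice_tensor, InnerProductSpace.rankOne_apply, inner_smul_right, inner_occ, inner_occ,
    occ_apply, occ_apply]
  congr 1
  split_ifs <;> simp_all

/-- The projection is a sum over the sets with p elements. Each contributes the same value, by
`chain_indicator` with s = sin² α, and counting them yields the binomial coefficient. -/
theorem numberProbability_eq [NeZero d] {ω : carAlgebra ℤ →ₗ[ℂ] ℂ} {σ : ℂ}
    (hq : IsGaugeInvariantQuasiFree ω (σ • ContinuousLinearMap.id ℂ (OneParticle ℤ)))
    (α : ℝ) (m p : ℕ) :
    numberProbability ω (InnerProductSpace.rankOne ℂ vacuum vacuum) (periodicShift d) α (m * d) p =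
      d.choose p * ((1 - Complex.cos α ^ (2 * m)) * σ) ^ p *
        (1 - (1 - Complex.cos α ^ (2 * m)) * σ) ^ (d - p) := by
  obtain ⟨Ω, hext⟩ := exists_extension ω
  have hΩ := hq.isScalarQuasiFree hext
  have hΩ1 : Ω 1 = 1 := by
    have := hΩ 0 0 Fin.elim0 Fin.elim0
    simpa [createWord, annihWord] using this
  have hcos : (1 - Complex.sin α ^ 2) ^ m = Complex.cos α ^ (2 * m) := by
    rw [pow_mul, ← Complex.sin_sq_add_cos_sq α]; ring
  have hR : ∀ R : Finset (Fin d), Ω (slice ∅ ∅ (heisenberg α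
      (tensorOp 1 (InnerProductSpace.rankOne ℂ (occ R) (occ R))) (m * d))) =
      ((1 - Complex.cos α ^ (2 * m)) * σ) ^ R.card *
        (1 - (1 - Complex.cos α ^ (2 * m)) * σ) ^ (d - R.card) := by
    intro R
    have hX : ∀ S T, slice S T (tensorOp 1 (InnerProductSpace.rankOne ℂ (occ R) (occ R))) ∈
        localAlgebra (Set.Ici (0 : ℤ)) := fun S T ↦ by
      rw [slice_occProj]; exact SMulMemClass.smul_mem _ (one_mem _)
    rw [← hcos]
    -- The chain is read off from the expectations of the diagonal slices; at time 0 they are the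
    -- indicator of `R`, because `Ω 1 = 1`.
    refine chain_indicator (g := fun t S ↦ Ω (slice S S (heisenberg α _ t)))
      (fun t S ↦ value_slice_heisenberg_succ hΩ α hX t S) (fun S ↦ ?_) m
    simp only [heisenberg, pow_zero, star_one, one_mul, mul_one]
    rw [slice_occProj, map_smul, hΩ1]
    split_ifs <;> simp
  have hsum : slice ∅ ∅ (evolve (periodicShift d) α (m * d) (sampleObs (numberProj d p)) :
      compositeAlgebra d).1 = ∑ R ∈ Finset.univ.filter fun R : Finset (Fin d) ↦ R.card = p,
      slice ∅ ∅ (heisenberg α (tensorOp 1 (InnerProductSpace.rankOne ℂ (occ R) (occ R)))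
        (m * d)) := by
    change slice ∅ ∅ (star (step (periodicShift d) α ^ (m * d)) * tensorOp 1 (numberProj d p) *
      step (periodicShift d) α ^ (m * d)) = _
    rw [numberProj_eq, tensorOp_sum, Finset.mul_sum, Finset.sum_mul]
    ext1 x
    rw [slice_apply, sum_apply, sum_apply, map_sum]
    simp only [slice_apply, heisenberg]
  rw [numberProbability, productState_vacuum, ← hext, hsum, map_sum,
    Finset.sum_congr rfl fun R hR' ↦ (hR R).trans (by rw [(Finset.mem_filter.mp hR').2]),
    Finset.sum_const, Finset.univ_filter_card_eq, Finset.card_powersetCard, Finset.card_univ,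
    Fintype.card_fin, nsmul_eq_mul, mul_assoc]

end NumberDistribution

end

end QuantumWalk

theorem mainTheorem11 (d : ℕ) [NeZero d] (α σ : ℝ) (hσ₀ : 0 ≤ σ) (hσ₁ : σ ≤ 1)
    (ω : carAlgebra ℤ →ₗ[ℂ] ℂ) (hω : IsState ω)
    (hq : IsGaugeInvariantQuasiFree ω ((σ : ℂ) • ContinuousLinearMap.id ℂ (OneParticle ℤ)))
    (m : ℕ) :
    (1 - Real.cos α ^ (2 * m)) * σ ∈ Set.Icc (0 : ℝ) 1 ∧
    ∀ p : ℕ,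
      numberProbability ω (InnerProductSpace.rankOne ℂ vacuum vacuum) (periodicShift d) α (m * d) p =
        ((d.choose p * ((1 - Real.cos α ^ (2 * m)) * σ) ^ p *
          (1 - (1 - Real.cos α ^ (2 * m)) * σ) ^ (d - p) : ℝ) : ℂ) := by
  have h0 : 0 ≤ Real.cos α ^ (2 * m) := by rw [pow_mul]; positivity
  have h1 : Real.cos α ^ (2 * m) ≤ 1 := by
    rw [pow_mul]; exact pow_le_one₀ (sq_nonneg _) (Real.cos_sq_le_one α)
  refine ⟨⟨mul_nonneg (by linarith) hσ₀, mul_le_one₀ (by linarith) hσ₀ hσ₁⟩, fun p ↦ ?_⟩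
  rw [numberProbability_eq hq]
  push_cast
  rfl
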